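/- Let $\mathcal P$ be a non-singular, non-symplectic classical polar space in $\mathrm{PG}(m,q)$, that is, the point set of a non-singular elliptic, hyperbolic or parabolic quadric or of a non-singular Hermitian variety. For a point $R$ of $\mathcal P$ let $R^\perp$ be the tangent hyperplane of $\mathcal P$ at $R$ (the hyperplane of points orthogonal to $R$ with respect to the sesquilinear form, respectively the polar form $Q(x+y)-Q(x)-Q(y)$, of $\mathcal P$). Call a set of points of $\mathrm{PG}(m,q)$ a quasi-polar space of the type of $\mathcal P$ if the set of its intersection sizes with the hyperplanes of $\mathrm{PG}(m,q)$ is the set of intersection sizes of a non-singular classical polar space of the type of $\mathcal P$ in $\mathrm{PG}(m,q)$. Let $P\neq Q$ be two collinear points of $\mathcal P$ (the line $PQ$ is contained in $\mathcal P$) and let $\xi=P^\perp\cap Q^\perp$. For every point $R$ of the line $PQ$ let $R\,\mathcal C'_R$ be a cone with vertex $R$ contained in $R^\perp$, whose base $\mathcal C'_R$ is a non-singular classical polar space of the same type (elliptic, hyperbolic, parabolic or Hermitian) as $\mathcal P$ in a hyperplane of $R^\perp$ not through $R$, and such that $R\,\mathcal C'_R\cap\xi=R^\perp\cap\mathcal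 P\cap\xi$. Then the set $$\mathcal P'=\bigcup_{R\in PQ}R\,\mathcal C'_R$$ is a quasi-polar space of the same type as $\mathcal P$. It arises from $\mathcal P$ by $q+1$ simultaneous pivots: the line $PQ$ has $q+1$ points $R$; the $R^\perp$ are pairwise distinct hyperplanes; each $R^\perp\cap\mathcal P$ is a cone with vertex $R$ over a non-singular polar space of the same type as $\mathcal P$ in a hyperplane of $R^\perp$ not through $R$; and $R^\perp\cap\mathcal P'=R\,\mathcal C'_R$. -/

import Mathlib

open scoped LinearAlgebra.Projectivization

/-- The four types of (non-symplectic) classical polar spaces. -/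
inductive PolarType where
  | elliptic
  | hyperbolic
  | parabolic
  | hermitian

/-- A Hermitian form on `V`: a sesquilinear form with respect to an involutory field
automorphism `conj` (different from the identity), conjugate-linear in the first argument and
linear in the second, with `h(y, x) = conj (h(x, y))`. -/
structure HermForm (K V : Type*) [Field K] [AddCommGroup V] [Module K V] where
  conj : K ≃+* K
  conj_conj : ∀ a, conj (conj a) = a
  conj_ne_refl : conj ≠ RingEquiv.refl K
  form : V →ₛₗ[(conj : K →+* K)] V →ₗ[K] K
  form_symm : ∀ x y, conj (form x y) = form y x

/-- The forms defining the non-symplectic classical polar spaces: quadratic forms and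
Hermitian forms. -/
inductive ClassicalForm (K V : Type*) [Field K] [AddCommGroup V] [Module K V] where
  | orthogonal (Q : QuadraticForm K V)
  | unitary (h : HermForm K V)

section

variable {K V : Type*} [Field K] [AddCommGroup V] [Module K V]

/-- A totally singular subspace: the quadratic form vanishes identically on it. -/
def IsTotallySingular (Q : QuadraticForm K V) (U : Submodule K V) : Prop :=
  ∀ u ∈ U, Q u = 0

/-- `r` is the Witt index of `Q`, i.e. the largest vector space dimension of a totally singular
subspace. -/
def HasWittIndex (Q : QuadraticForm K V) (r : ℕ) : Prop :=
  (∃ U : Submodule K V, IsTotallySingular Q U ∧ Module.finrank K U = r) ∧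
    ∀ U : Submodule K V, IsTotallySingular Q U → Module.finrank K U ≤ r

namespace ClassicalForm

/-- The point set of the polar space: the projective points on which the form vanishes. -/
def points : ClassicalForm K V → Set (ℙ K V)
  | orthogonal Q => {p | Q p.rep = 0}
  | unitary h => {p | h.form p.rep p.rep = 0}

/-- The subspace `R^⊥`. For a quadratic form it is taken with respect to the polar form
`Q (x + y) - Q x - Q y`; thus for a point `R` of a quadric it is the tangent hyperplane at `R`,
also for parabolic quadrics in even characteristic. -/
noncomputable def perp : ClassicalForm K V → ℙ K V → Submodule K V
  | orthogonal Q, R => LinearMap.ker (QuadraticMap.polarBilin Q R.rep)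
  | unitary h, R => LinearMap.ker (h.form R.rep)

/-- Non-singularity. A quadratic form is non-singular if no non-zero singular vector is
orthogonal to the whole space (so that a nucleus is allowed in characteristic two). -/
def Nonsingular : ClassicalForm K V → Prop
  | orthogonal Q => ∀ x, Q x = 0 → (∀ y, QuadraticMap.polar Q x y = 0) → x = 0
  | unitary h => ∀ x, (∀ y, h.form x y = 0) → x = 0

/-- The type of a form. With `r` the Witt index, a non-singular quadric is hyperbolic, parabolic
or elliptic according as the vector space dimension is `2r`, `2r + 1` or `2r + 2`. -/
def HasType : ClassicalForm K V → PolarType → Prop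
  | orthogonal Q, .hyperbolic => ∃ r, HasWittIndex Q r ∧ Module.finrank K V = 2 * r
  | orthogonal Q, .parabolic => ∃ r, HasWittIndex Q r ∧ Module.finrank K V = 2 * r + 1
  | orthogonal Q, .elliptic => ∃ r, HasWittIndex Q r ∧ Module.finrank K V = 2 * r + 2
  | orthogonal _, .hermitian => False
  | unitary _, .hermitian => True
  | unitary _, _ => False

end ClassicalForm

/-- `S` is (the point set of) a non-singular classical polar space of type `t` in the projective
space of `V`. -/
def IsPolarSpace (t : PolarType) (S : Set (ℙ K V)) : Prop :=
  ∃ F : ClassicalForm K V, F.Nonsingular ∧ F.HasType t ∧ S = F.points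

/-- The projective points contained in the subspace `W`. -/
def pointsOf (W : Submodule K V) : Set (ℙ K V) :=
  {p | p.submodule ≤ W}

/-- The points of the line joining `P` and `Q` (for `P ≠ Q`). -/
def lineThrough (P Q : ℙ K V) : Set (ℙ K V) :=
  pointsOf (P.submodule ⊔ Q.submodule)

/-- `S` is a non-singular classical polar space of type `t` in the projective space of the
subspace `W` of `V`. -/
def IsPolarSpaceIn (t : PolarType) (W : Submodule K V) (S : Set (ℙ K V)) : Prop :=
  ∃ S₀ : Set (ℙ K W), IsPolarSpace t S₀ ∧
    S = Projectivization.map W.subtype W.injective_subtype '' S₀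

/-- The cone with vertex the point `R` and base `C`: the point `R` together with all points on
the lines joining `R` to the points of `C`. -/
def cone (R : ℙ K V) (C : Set (ℙ K V)) : Set (ℙ K V) :=
  {R} ∪ ⋃ Y ∈ C, lineThrough R Y

/-- `D` is a cone `R C` in the subspace `π`, whose base `C` is a non-singular polar space of
type `t` in a hyperplane `W` of `π` not through the vertex `R`. -/
def IsPolarCone (t : PolarType) (R : ℙ K V) (π : Submodule K V) (D : Set (ℙ K V)) : Prop :=
  ∃ (W : Submodule K V) (C : Set (ℙ K V)),
    R.submodule ⊓ W = ⊥ ∧ R.submodule ⊔ W = π ∧ IsPolarSpaceIn t W C ∧ D = cone R C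

/-- The set of intersection sizes of `S` with the hyperplanes of the projective space of `V`. -/
def hyperplaneSizes (S : Set (ℙ K V)) : Set ℕ :=
  {k | ∃ H : Submodule K V, IsCoatom H ∧ (S ∩ pointsOf H).ncard = k}

/-- A quasi-polar space of type `t`: a point set with the same intersection sizes with
hyperplanes as a non-singular classical polar space of type `t` in the same projective space. -/
def IsQuasiPolarSpace (t : PolarType) (S : Set (ℙ K V)) : Prop :=
  ∃ S₀ : Set (ℙ K V), IsPolarSpace t S₀ ∧ hyperplaneSizes S = hyperplaneSizes S₀

end

/-! Write `Λ` for the line `PQ` and `ξ = Λ^⊥`. Any vector is orthogonal to some point of `Λ`, so `𝒫`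
is itself the union of its tangent cones along `Λ`. Thus `𝒫` and `𝒫'` are two instances of one
notion, `PolarForm.IsPivotFamily`, and it suffices to match every hyperplane section of one family
with an equally large section of the other; exchanging the roles gives both inclusions.

Tangent hyperplanes at distinct points of `Λ` meet in `ξ`, where all cones agree with `𝒫`. Hence a
section by `H` splits into the common part in `ξ` and the disjoint parts of the cones outside `ξ`
(`IsPivotFamily.ncard_iUnion`).

If `H` contains `Λ`, take `y ∈ Λ` off the vertex `R`. The form of the cone vanishes on `ξ` exactly
where that of `𝒫` does, which forces `y` to be orthogonal to `ξ` for the cone form too, and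
nonsingularity of the base then makes `y` orthogonal to nothing in `R^⊥` outside `ξ`. Translating by
multiples of `y` shows that the cone has a fixed density in `(R^⊥ ∩ H) \ ξ`
(`IsPivotFamily.ncard_mul_eq`), so `H` itself works for both families.

If `H` meets `Λ` in one point `R₀`, every cone with vertex `R ≠ R₀` is cut outside `ξ` to a fraction
`1/|K|` of its size, by translation along `R`; the part in `ξ` is cut likewise, by translation along
a vector `y ∈ Λ` outside `H`. Only the cone at `R₀` is sensitive to `H`. There a similarity between
the two bases carrying the image of `y` to the image of `y` transports `H` to a hyperplane `H'`
through `R₀` and not through `y`, with an equal section (`IsVectorCone.exists_ncard_eq`).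

Such similarities come from splitting off hyperbolic planes and classifying the remaining small
forms over a finite field (`HasType.exists_similarity`). Quadratic and Hermitian forms are treated
together: both have values in the fixed field of `σ` and satisfy `val (x + y) = val x + val y + T
(bil x y)`, with `T` the identity or the trace. -/

/-! ### Quadratic and Hermitian forms in one framework; hyperbolic pairs -/

/-- The properties shared by the identity map (with trivial conjugation) and by the trace map
`a ↦ a + σ a` of an involutory field automorphism `σ`. -/
structure IsTraceMap {K : Type*} [Field K] (σ : K ≃+* K) (T : K →+ K) : Prop where
  conj_conj : ∀ a, σ (σ a) = a
  map_mul : ∀ c a, σ c = c → T (c * a) = c * T a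
  map_conj : ∀ a, T (σ a) = T a
  conj_map : ∀ a, σ (T a) = T a
  surj : ∀ c, σ c = c → ∃ a, T a = c

/-- A common generalization of quadratic and Hermitian forms: the map `val` is polarized by
`T ∘ bil`. -/
structure PolarForm {K : Type*} [Field K] (σ : K ≃+* K) (T : K →+ K)
    (V : Type*) [AddCommGroup V] [Module K V] where
  val : V → K
  bil : V → V →ₗ[K] K
  val_smul : ∀ a x, val (a • x) = a * σ a * val x
  val_add : ∀ x y, val (x + y) = val x + val y + T (bil x y)
  bil_symm : ∀ x y, σ (bil x y) = bil y x
  conj_val : ∀ x, σ (val x) = val x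

namespace IsTraceMap

variable {K : Type*} [Field K] {σ : K ≃+* K} {T : K →+ K}

lemma exists_eq_mul (hT : IsTraceMap σ T) {u c : K} (hu : u ≠ 0) (hc : σ c = c) :
    ∃ a, T (a * u) = c := by
  obtain ⟨a, ha⟩ := hT.surj c hc
  exact ⟨a / u, by rw [div_mul_cancel₀ _ hu, ha]⟩

lemma eq_zero_of_forall (hT : IsTraceMap σ T) {u : K} (h : ∀ a, T (a * u) = 0) : u = 0 := by
  by_contra hu
  obtain ⟨a, ha⟩ := hT.exists_eq_mul hu (map_one σ)
  rw [h a] at ha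
  exact zero_ne_one ha

end IsTraceMap

namespace PolarForm

variable {K : Type*} [Field K] {σ : K ≃+* K} {T : K →+ K}
  {V V' W : Type*} [AddCommGroup V] [Module K V] [AddCommGroup V'] [Module K V']
  [AddCommGroup W] [Module K W]

section
variable (G : PolarForm σ T V)

/-- Non-singularity: the radical contains no non-zero singular vector. -/
def Nonsingular : Prop := ∀ x, G.val x = 0 → (∀ y, G.bil x y = 0) → x = 0

/-- The pull-back of a form along a linear map. -/
def comap (φ : W →ₗ[K] V) : PolarForm σ T W where
  val x := G.val (φ x)
  bil x := (G.bil (φ x)).comp φ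
  val_smul a x := by rw [map_smul, G.val_smul]
  val_add x y := by rw [map_add, G.val_add]; rfl
  bil_symm x y := G.bil_symm _ _
  conj_val x := G.conj_val _

@[simp] lemma comap_val (φ : W →ₗ[K] V) (x : W) : (G.comap φ).val x = G.val (φ x) := rfl
@[simp] lemma comap_bil (φ : W →ₗ[K] V) (x y : W) : (G.comap φ).bil x y = G.bil (φ x) (φ y) := rfl

lemma val_zero : G.val 0 = 0 := by simpa using G.val_smul 0 0

lemma val_smul_eq_zero {x : V} (hx : G.val x = 0) (a : K) : G.val (a • x) = 0 := by
  rw [G.val_smul, hx, mul_zero]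

lemma val_smul_eq_zero_iff {x : V} {a : K} (ha : a ≠ 0) : G.val (a • x) = 0 ↔ G.val x = 0 := by
  rw [G.val_smul]
  simp [ha]

lemma bil_add_left (x y z : V) : G.bil (x + y) z = G.bil x z + G.bil y z := by
  rw [← G.bil_symm z, map_add, map_add, G.bil_symm, G.bil_symm]

lemma bil_smul_left (a : K) (x z : V) : G.bil (a • x) z = σ a * G.bil x z := by
  rw [← G.bil_symm z, map_smul, smul_eq_mul, map_mul, G.bil_symm]

lemma bil_eq_zero_symm {x y : V} (h : G.bil x y = 0) : G.bil y x = 0 := by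
  rw [← G.bil_symm, h, map_zero]

variable {G}

lemma val_add_smul_of_val_eq_zero (hT : IsTraceMap σ T) {y : V} (hy : G.val y = 0) (x : V)
    (a : K) : G.val (x + a • y) = G.val x + T (σ a * G.bil y x) := by
  rw [G.val_add, G.val_smul, hy, mul_zero, add_zero, map_smul, smul_eq_mul, ← hT.map_conj,
    map_mul, G.bil_symm]

/-- Along the line `x + a • y` the value changes by `T (σ a * bil y x)`, which runs through the
whole fixed field of `σ`, where `val` takes its values. -/
lemma exists_val_add_smul_eq_zero (hT : IsTraceMap σ T) {y : V} (hy : G.val y = 0) {x : V}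
    (hxy : G.bil y x ≠ 0) : ∃ a : K, G.val (x + a • y) = 0 := by
  obtain ⟨a, ha⟩ := hT.exists_eq_mul (c := - G.val x) hxy (by rw [map_neg, G.conj_val])
  refine ⟨σ a, ?_⟩
  rw [val_add_smul_of_val_eq_zero hT hy, hT.conj_conj, ha, add_neg_cancel]

lemma bil_eq_zero_of_forall (hT : IsTraceMap σ T) {x y : V} (hx : G.val x = 0) (hy : G.val y = 0)
    (h : ∀ a : K, G.val (x + a • y) = 0) : G.bil y x = 0 := by
  refine hT.eq_zero_of_forall fun a => ?_
  have := h (σ a)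
  rwa [val_add_smul_of_val_eq_zero hT hy, hT.conj_conj, hx, zero_add] at this

lemma bil_self (hT : IsTraceMap σ T) {y : V} (hy : G.val y = 0) : G.bil y y = 0 :=
  bil_eq_zero_of_forall hT hy hy fun a => by
    have h : y + a • y = (1 + a) • y := by rw [add_smul, one_smul]
    rw [h]
    exact G.val_smul_eq_zero hy _

/-- A hyperbolic pair. -/
structure IsHyperbolicPair (G : PolarForm σ T V) (y z : V) : Prop where
  val_left : G.val y = 0
  val_right : G.val z = 0
  bil_eq : G.bil y z = 1

/-- Nonsingularity supplies a vector not orthogonal to `y`; sliding it along `y` makes it singular,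
and rescaling normalizes the pairing. -/
lemma exists_isHyperbolicPair (hT : IsTraceMap σ T) (hG : G.Nonsingular) {y : V} (hy : G.val y = 0)
    (hy0 : y ≠ 0) : ∃ z, G.IsHyperbolicPair y z := by
  obtain ⟨z, hz⟩ : ∃ z, G.bil y z ≠ 0 := by
    by_contra! h
    exact hy0 (hG y hy h)
  obtain ⟨a, ha⟩ := exists_val_add_smul_eq_zero hT hy hz
  refine ⟨(G.bil y z)⁻¹ • (z + a • y), hy, G.val_smul_eq_zero ha _, ?_⟩
  rw [map_smul, map_add, map_smul, bil_self hT hy, smul_zero, add_zero, smul_eq_mul,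
    inv_mul_cancel₀ hz]

/-- The orthogonal complement of a pair of vectors. -/
def pairPerp (G : PolarForm σ T V) (y z : V) : Submodule K V :=
  LinearMap.ker (G.bil y) ⊓ LinearMap.ker (G.bil z)

lemma mem_pairPerp {y z v : V} : v ∈ G.pairPerp y z ↔ G.bil y v = 0 ∧ G.bil z v = 0 := Iff.rfl

namespace IsHyperbolicPair

variable {y z : V}

lemma bil_eq' (h : G.IsHyperbolicPair y z) : G.bil z y = 1 := by
  rw [← G.bil_symm, h.bil_eq, map_one]

/-- Splitting off a hyperbolic plane. -/
def split (hT : IsTraceMap σ T) (h : G.IsHyperbolicPair y z) :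
    V ≃ₗ[K] (K × K) × G.pairPerp y z where
  toFun v := ((G.bil z v, G.bil y v), ⟨v - (G.bil z v • y + G.bil y v • z), by
    simp [mem_pairPerp, h.bil_eq, h.bil_eq', bil_self hT h.val_left, bil_self hT h.val_right]⟩)
  map_add' v w := by
    ext <;> simp [add_smul]
    abel
  map_smul' a v := by
    ext <;> simp [mul_smul, smul_sub]
  invFun u := u.1.1 • y + u.1.2 • z + u.2
  left_inv v := by simp
  right_inv u := by
    obtain ⟨⟨α, β⟩, w, hw⟩ := u
    obtain ⟨h1, h2⟩ := mem_pairPerp.1 hw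
    ext <;> simp [h.bil_eq, h.bil_eq', bil_self hT h.val_left, bil_self hT h.val_right, h1, h2]

lemma split_symm_apply (hT : IsTraceMap σ T) (h : G.IsHyperbolicPair y z)
    (u : (K × K) × G.pairPerp y z) :
    (h.split hT).symm u = u.1.1 • y + u.1.2 • z + u.2 := rfl

lemma split_apply_left (hT : IsTraceMap σ T) (h : G.IsHyperbolicPair y z) :
    h.split hT y = ((1, 0), 0) := by
  rw [← LinearEquiv.eq_symm_apply, split_symm_apply]
  simp

lemma val_split_symm (hT : IsTraceMap σ T) (h : G.IsHyperbolicPair y z)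
    (u : (K × K) × G.pairPerp y z) :
    G.val ((h.split hT).symm u) = T (σ u.1.1 * u.1.2) + G.val u.2 := by
  obtain ⟨⟨α, β⟩, w, hw⟩ := u
  obtain ⟨h1, h2⟩ := mem_pairPerp.1 hw
  rw [split_symm_apply, G.val_add, G.val_add, G.val_smul_eq_zero h.val_left,
    G.val_smul_eq_zero h.val_right, G.bil_smul_left, map_smul, h.bil_eq, G.bil_add_left,
    G.bil_smul_left, G.bil_smul_left, h1, h2]
  simp

lemma finrank_pairPerp [FiniteDimensional K V] (hT : IsTraceMap σ T)
    (h : G.IsHyperbolicPair y z) :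
    Module.finrank K V = Module.finrank K (G.pairPerp y z) + 2 := by
  rw [(h.split hT).finrank_eq, Module.finrank_prod, Module.finrank_prod, Module.finrank_self]
  omega

lemma nonsingular_pairPerp (hT : IsTraceMap σ T) (h : G.IsHyperbolicPair y z)
    (hG : G.Nonsingular) : (G.comap (G.pairPerp y z).subtype).Nonsingular := by
  rintro ⟨w, hw⟩ hv hb
  obtain ⟨h1, h2⟩ := mem_pairPerp.1 hw
  refine Subtype.ext (hG w hv fun x => ?_)
  rw [← (h.split hT).symm_apply_apply x, split_symm_apply, map_add, map_add, map_smul, map_smul,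
    G.bil_eq_zero_symm h1, G.bil_eq_zero_symm h2]
  simpa using hb _

end IsHyperbolicPair

/-- Two forms are similar if a linear equivalence carries one into a multiple of the other. -/
def Similar (G : PolarForm σ T V) (G' : PolarForm σ T V') : Prop :=
  ∃ (φ : V ≃ₗ[K] V') (c : K), c ≠ 0 ∧ σ c = c ∧ ∀ x, G'.val (φ x) = c * G.val x

/-- The factor `c` is absorbed in the second hyperbolic coordinate alone, so the hyperbolic plane is
scaled by `c` as well while `y` still goes exactly to `y'`. -/
lemma IsHyperbolicPair.exists_similarity {G' : PolarForm σ T V'} (hT : IsTraceMap σ T) {y z : V}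
    {y' z' : V'} (h : G.IsHyperbolicPair y z) (h' : G'.IsHyperbolicPair y' z')
    (hs : (G.comap (G.pairPerp y z).subtype).Similar (G'.comap (G'.pairPerp y' z').subtype)) :
    ∃ (φ : V ≃ₗ[K] V') (c : K), c ≠ 0 ∧ σ c = c ∧ (∀ x, G'.val (φ x) = c * G.val x) ∧
      φ y = y' := by
  obtain ⟨φ, c, hc, hσ, hφ⟩ := hs
  let m : K ≃ₗ[K] K := LinearEquiv.smulOfNeZero K K c hc
  let ψ := ((LinearEquiv.refl K K).prodCongr m).prodCongr φ
  refine ⟨(h.split hT).trans (ψ.trans (h'.split hT).symm), c, hc, hσ, fun x => ?_, ?_⟩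
  · obtain ⟨u, rfl⟩ := (h.split hT).symm.surjective x
    have := hφ u.2
    simp only [comap_val, Submodule.subtype_apply] at this
    rw [h.val_split_symm]
    simp only [LinearEquiv.trans_apply, LinearEquiv.apply_symm_apply, h'.val_split_symm]
    have e1 : (ψ u).1.1 = u.1.1 := rfl
    have e2 : (ψ u).1.2 = c * u.1.2 := rfl
    have e3 : (ψ u).2 = φ u.2 := rfl
    rw [e1, e2, e3, this, mul_left_comm, hT.map_mul _ _ hσ, mul_add]
  · simp only [LinearEquiv.trans_apply, h.split_apply_left]
    rw [LinearEquiv.symm_apply_eq, h'.split_apply_left]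
    ext <;> simp [ψ, m]

end

end PolarForm

/-! ### Finite fields: involutions, norms, nonsquares and the map `u ↦ u ^ 2 + u` -/

section FiniteField

variable {K : Type*} [Field K]

lemma isTraceMap_refl : IsTraceMap (RingEquiv.refl K) (AddMonoidHom.id K) where
  conj_conj _ := rfl
  map_mul _ _ _ := rfl
  map_conj _ := rfl
  conj_map _ := rfl
  surj c _ := ⟨c, rfl⟩

/-- The trace map of an involutory automorphism. -/
def conjTrace (σ : K ≃+* K) : K →+ K := AddMonoidHom.id K + (σ : K →+ K)

lemma conjTrace_apply (σ : K ≃+* K) (a : K) : conjTrace σ a = a + σ a := rfl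

lemma exists_conjTrace_ne_zero {σ : K ≃+* K} (h1 : σ ≠ RingEquiv.refl K) :
    ∃ a, a + σ a ≠ 0 := by
  by_contra! h
  refine h1 (RingEquiv.ext fun a => ?_)
  have e1 := h a
  have e2 := h 1
  rw [map_one] at e2
  simp only [RingEquiv.refl_apply]
  linear_combination e1 - a * e2

lemma isTraceMap_conjTrace {σ : K ≃+* K} (hσ : ∀ a, σ (σ a) = a) (h1 : σ ≠ RingEquiv.refl K) :
    IsTraceMap σ (conjTrace σ) where
  conj_conj := hσ
  map_mul c a hc := by simp only [conjTrace_apply, map_mul, hc]; ring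
  map_conj a := by simp only [conjTrace_apply, hσ, add_comm]
  conj_map a := by simp only [conjTrace_apply, map_add, hσ, add_comm]
  surj c hc := by
    obtain ⟨a, ha⟩ := exists_conjTrace_ne_zero h1
    refine ⟨c * (a / (a + σ a)), ?_⟩
    have h : σ a + a ≠ 0 := by rwa [add_comm]
    simp only [conjTrace_apply, map_mul, map_div₀, map_add, hσ, hc]
    field_simp
    ring

variable [Finite K]

/-- Involutory automorphisms of a finite field are unique. -/
lemma involution_unique {σ τ : K ≃+* K} (hσ : ∀ a, σ (σ a) = a) (hσ1 : σ ≠ RingEquiv.refl K)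
    (hτ : ∀ a, τ (τ a) = a) (hτ1 : τ ≠ RingEquiv.refl K) : σ = τ := by
  classical
  obtain ⟨p, hp⟩ := CharP.exists K
  have : Fact p.Prime := ⟨CharP.char_is_prime K p⟩
  let : Algebra (ZMod p) K := ZMod.algebra K p
  have lift : ∀ ρ : K ≃+* K, ∃ f : Gal(K/ZMod p), ∀ a, f a = ρ a := fun ρ =>
    ⟨AlgEquiv.ofRingEquiv (f := ρ) fun x => by
      have : (ρ : K →+* K).comp (algebraMap (ZMod p) K) = algebraMap (ZMod p) K :=
        Subsingleton.elim _ _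
      exact RingHom.congr_fun this x, fun a => rfl⟩
  obtain ⟨f, hf⟩ := lift σ
  obtain ⟨g, hg⟩ := lift τ
  have : Finite Gal(K/ZMod p) := DFunLike.finite _
  let := Fintype.ofFinite Gal(K/ZMod p)
  -- The Galois group over the prime field is cyclic, so it has no room for three solutions `1`,
  -- `f`, `g` of `a ^ 2 = 1`.
  have hcard := IsCyclic.card_pow_eq_one_le (α := Gal(K/ZMod p)) (n := 2) two_pos
  have hf2 : f ^ 2 = 1 := by
    ext a
    simp [pow_two, hf, hσ]
  have hg2 : g ^ 2 = 1 := by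
    ext a
    simp [pow_two, hg, hτ]
  have hf1 : f ≠ 1 := fun h => hσ1 (RingEquiv.ext fun a => by rw [← hf, h]; rfl)
  have hg1 : g ≠ 1 := fun h => hτ1 (RingEquiv.ext fun a => by rw [← hg, h]; rfl)
  by_contra hne
  have hfg : f ≠ g := fun h => hne (RingEquiv.ext fun a => by rw [← hf, h, hg])
  have hsub : ({1, f, g} : Finset Gal(K/ZMod p)) ⊆
      Finset.univ.filter fun a => a ^ 2 = 1 := by
    intro x hx
    simp only [Finset.mem_insert, Finset.mem_singleton] at hx
    rcases hx with rfl | rfl | rfl <;> simp [hf2, hg2]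
  have := Finset.card_le_card hsub
  rw [Finset.card_eq_three.2 ⟨1, f, g, hf1.symm, hg1.symm, hfg, rfl⟩] at this
  omega

/-- The norm of an involutory automorphism of a finite field is surjective onto the fixed
field. -/
lemma exists_mul_conj_eq {σ : K ≃+* K} (hσ : ∀ a, σ (σ a) = a) (h1 : σ ≠ RingEquiv.refl K)
    {k : K} (hk : σ k = k) : ∃ x, x * σ x = k := by
  rcases eq_or_ne k 0 with rfl | hk0
  · exact ⟨0, by simp⟩
  let s : Kˣ →* Kˣ := Units.map (σ : K →* K)
  have hs : ∀ u : Kˣ, ((s u : Kˣ) : K) = σ u := fun u => rfl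
  let f : Kˣ →* Kˣ := MonoidHom.id Kˣ / s
  let g : Kˣ →* Kˣ := MonoidHom.id Kˣ * s
  have hf : ∀ u, f u = u / s u := fun u => rfl
  have hg : ∀ u, g u = u * s u := fun u => rfl
  have hss : ∀ u, s (s u) = u := fun u => Units.ext (by rw [hs, hs, hσ])
  -- Hilbert 90: elements of norm one are the quotients `v / σ v`. With `v = a + u * σ a ≠ 0` one
  -- has `u * σ v = v`; if every such `v` vanished, `a = 1` would give `u = -1`, and then `σ` would
  -- be the identity.
  have hker : g.ker = f.range := by
    ext u
    constructor
    · intro hu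
      rw [MonoidHom.mem_ker, hg] at hu
      have hu' : (u : K) * σ u = 1 := by rw [← hs, ← Units.val_mul, hu, Units.val_one]
      obtain ⟨a, ha⟩ : ∃ a, a + u * σ a ≠ 0 := by
        by_contra! h
        have e1 := h 1
        rw [map_one, mul_one] at e1
        refine h1 (RingEquiv.ext fun a => ?_)
        have e2 := h a
        simp only [RingEquiv.refl_apply]
        linear_combination σ a * e1 - e2
      refine ⟨Units.mk0 _ ha, ?_⟩
      rw [hf, div_eq_iff_eq_mul]
      ext
      rw [Units.val_mul, hs]
      simp only [Units.val_mk0, map_add, map_mul, hσ]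
      linear_combination (-a) * hu'
    · rintro ⟨v, rfl⟩
      rw [MonoidHom.mem_ker, hg, hf, map_div, hss]
      simp
  -- Since `|ker g| = |range f|`, orders force the norms to fill `ker f`, the units fixed by `σ`.
  have hcard : Nat.card g.range = Nat.card f.ker := by
    have e1 := Subgroup.card_mul_index g.ker
    have e2 := Subgroup.card_mul_index f.ker
    rw [Subgroup.index_ker] at e1 e2
    rw [← hker] at e2
    have : 0 < Nat.card g.ker := Nat.card_pos
    exact Nat.eq_of_mul_eq_mul_left this (by rw [e1, mul_comm, e2])
  have hle : g.range ≤ f.ker := by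
    rintro _ ⟨u, rfl⟩
    rw [MonoidHom.mem_ker, hf, hg, map_mul, hss, mul_comm, div_self']
  have heq : g.range = f.ker := Subgroup.eq_of_le_of_card_ge hle hcard.ge
  have hkm : Units.mk0 k hk0 ∈ f.ker := by
    rw [MonoidHom.mem_ker, hf, div_eq_one]
    ext
    rw [hs, Units.val_mk0, hk]
  rw [← heq] at hkm
  obtain ⟨x, hx⟩ := hkm
  exact ⟨x, by rw [← hs, ← Units.val_mul, ← hg, hx, Units.val_mk0]⟩

/-- The quadratic character is multiplicative, so the product of two nonsquares is a square. -/
lemma exists_eq_sq_mul_of_not_isSquare (h2 : (2 : K) ≠ 0) {d e : K} (hd : ¬ IsSquare d)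
    (he : ¬ IsSquare e) : ∃ t, d = t ^ 2 * e := by
  classical
  let := Fintype.ofFinite K
  have hr : ringChar K ≠ 2 := fun h => h2 (by exact_mod_cast (ringChar.spec K 2).2 h.dvd)
  have he0 : e ≠ 0 := by rintro rfl; exact he IsSquare.zero
  have hd0 : d ≠ 0 := by rintro rfl; exact hd IsSquare.zero
  have h1 : quadraticChar K (d * e) = 1 := by
    rw [map_mul, quadraticChar_neg_one_iff_not_isSquare.2 hd,
      quadraticChar_neg_one_iff_not_isSquare.2 he]
    norm_num
  rw [quadraticChar_one_iff_isSquare (mul_ne_zero hd0 he0)] at h1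
  obtain ⟨s, hs⟩ := h1
  refine ⟨s / e, ?_⟩
  field_simp
  linear_combination hs

/-- In characteristic two `u ↦ u ^ 2 + u` is additive with kernel `{0, 1}`, so its image has index
two and two elements outside it differ by an element of it. -/
lemma exists_eq_add_sq_add_self (h2 : (2 : K) = 0) {c d : K} (hc : ∀ u, c ≠ u ^ 2 + u)
    (hd : ∀ u, d ≠ u ^ 2 + u) : ∃ u, c = d + (u ^ 2 + u) := by
  let f : K →+ K :=
    { toFun := fun u => u ^ 2 + u
      map_zero' := by ring
      map_add' := fun x y => by linear_combination (x * y) * h2 }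
  have hker : (f.ker : Set K) = {0, 1} := by
    ext u
    have : u ^ 2 + u = u * (u - 1) := by linear_combination u * h2
    change u ^ 2 + u = 0 ↔ _
    rw [this, mul_eq_zero, sub_eq_zero]
    rfl
  have hk : Nat.card f.ker = 2 := by
    change Nat.card (f.ker : Set K) = 2
    rw [hker, Nat.card_coe_set_eq, Set.ncard_pair zero_ne_one]
  have e1 := AddSubgroup.card_mul_index f.ker
  have e2 := AddSubgroup.card_mul_index f.range
  rw [AddSubgroup.index_ker, hk] at e1
  have hidx : f.range.index = 2 := by
    have : 0 < Nat.card f.range := Nat.card_pos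
    exact Nat.eq_of_mul_eq_mul_left this (by rw [e2, mul_comm, e1])
  have hc' : c ∉ f.range := fun ⟨u, hu⟩ => hc u hu.symm
  have hd' : d ∉ f.range := fun ⟨u, hu⟩ => hd u hu.symm
  obtain ⟨u, hu⟩ : c + d ∈ f.range := by
    rw [AddSubgroup.add_mem_iff_of_index_two hidx]
    tauto
  refine ⟨u, ?_⟩
  change u ^ 2 + u = c + d at hu
  linear_combination (-d) * h2 - hu

end FiniteField

/-! ### Classification of nonsingular forms up to similarity -/

namespace PolarForm

variable {K : Type*} [Field K] {σ : K ≃+* K} {T : K →+ K}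
  {V V' W : Type*} [AddCommGroup V] [Module K V] [AddCommGroup V'] [Module K V']
  [AddCommGroup W] [Module K W]

/-- A form is anisotropic if it has no non-zero singular vectors. -/
def Anisotropic (G : PolarForm σ T V) : Prop := ∀ x, G.val x = 0 → x = 0

lemma Nonsingular.anisotropic_of_finrank_le_one [FiniteDimensional K V] {G : PolarForm σ T V}
    (hT : IsTraceMap σ T) (hG : G.Nonsingular) (hV : Module.finrank K V ≤ 1) :
    G.Anisotropic := by
  intro x hx
  by_contra hx0
  obtain ⟨z, hz⟩ := exists_isHyperbolicPair hT hG hx hx0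
  have := hz.finrank_pairPerp hT
  omega

/-- Dimension one is the reason for working with similarity: one-dimensional anisotropic forms need
not be isometric, but a scalar factor always relates them. -/
lemma similar_of_finrank_le_one [FiniteDimensional K V] [FiniteDimensional K V']
    {G : PolarForm σ T V} {G' : PolarForm σ T V'}
    (hG : G.Anisotropic) (hG' : G'.Anisotropic)
    (h : Module.finrank K V = Module.finrank K V') (h1 : Module.finrank K V ≤ 1) :
    G.Similar G' := by
  rcases Nat.le_one_iff_eq_zero_or_eq_one.1 h1 with h0 | h1
  · have := Module.finrank_zero_iff.1 h0
    refine ⟨LinearEquiv.ofFinrankEq V V' h, 1, one_ne_zero, map_one σ, fun x => ?_⟩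
    rw [Subsingleton.elim x 0, map_zero, G.val_zero, G'.val_zero, mul_zero]
  · obtain ⟨e, he, hspan⟩ := finrank_eq_one_iff'.1 h1
    let φ := LinearEquiv.ofFinrankEq V V' h
    have hne : G.val e ≠ 0 := fun h => he (hG e h)
    have hne' : G'.val (φ e) ≠ 0 := fun h => he (φ.map_eq_zero_iff.1 (hG' _ h))
    refine ⟨φ, G'.val (φ e) / G.val e, div_ne_zero hne' hne, ?_, fun x => ?_⟩
    · rw [map_div₀, G.conj_val, G'.conj_val]
    · obtain ⟨a, rfl⟩ := hspan x
      rw [map_smul, G.val_smul, G'.val_smul]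
      field_simp

lemma exists_notMem_span_singleton [FiniteDimensional K V] (h : 2 ≤ Module.finrank K V) (e : V) :
    ∃ v, v ∉ Submodule.span K {e} := by
  by_contra! hv
  have : Submodule.span K {e} = ⊤ := Submodule.eq_top_iff'.2 hv
  have h1 := finrank_span_le_card (R := K) ({e} : Set V)
  rw [this, finrank_top, Set.toFinset_singleton, Finset.card_singleton] at h1
  omega

section Binary

/-- `f` is, up to a scalar factor, the binary form describing `G`. -/
def HasBinaryForm (G : PolarForm σ T V) (f : K → K → K) : Prop :=
  ∃ e₁ e₂ : V, ∃ n : K, n ≠ 0 ∧ σ n = n ∧ ∀ x y, G.val (x • e₁ + y • e₂) = n * f x y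

lemma HasBinaryForm.exists_basis {G : PolarForm σ T V} {f : K → K → K} (hf : G.HasBinaryForm f)
    (hf0 : ∀ x y, f x y = 0 → x = 0 ∧ y = 0) (hV : Module.finrank K V = 2) :
    ∃ (b : Module.Basis (Fin 2) K V) (n : K), n ≠ 0 ∧ σ n = n ∧
      ∀ v, G.val v = n * f (b.repr v 0) (b.repr v 1) := by
  obtain ⟨e₁, e₂, n, hn, hσ, h⟩ := hf
  have hli : LinearIndependent K ![e₁, e₂] := by
    rw [LinearIndependent.pair_iff]
    intro s t hst
    have := h s t
    rw [hst, G.val_zero, zero_eq_mul] at this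
    exact hf0 _ _ (this.resolve_left hn)
  refine ⟨basisOfLinearIndependentOfCardEqFinrank hli (by simp [hV]), n, hn, hσ, fun v => ?_⟩
  rw [← h]
  congr 1
  conv_lhs => rw [← (basisOfLinearIndependentOfCardEqFinrank hli (by simp [hV])).sum_repr v]
  simp [Fin.sum_univ_two]

lemma HasBinaryForm.similar {G : PolarForm σ T V} {G' : PolarForm σ T V'} {f : K → K → K}
    (hf : G.HasBinaryForm f) (hf' : G'.HasBinaryForm f) (hf0 : ∀ x y, f x y = 0 → x = 0 ∧ y = 0)
    (hV : Module.finrank K V = 2) (hV' : Module.finrank K V' = 2) : G.Similar G' := by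
  obtain ⟨b, n, hn, hσ, h⟩ := hf.exists_basis hf0 hV
  obtain ⟨b', n', hn', hσ', h'⟩ := hf'.exists_basis hf0 hV'
  refine ⟨b.equiv b' (Equiv.refl _), n' / n, div_ne_zero hn' hn, by rw [map_div₀, hσ, hσ'],
    fun x => ?_⟩
  rw [h, h']
  have : ∀ i, b'.repr (b.equiv b' (Equiv.refl _) x) i = b.repr x i := by
    intro i
    simp [Module.Basis.equiv]
  rw [this, this]
  field_simp

end Binary

section Quadratic

variable {G : PolarForm (RingEquiv.refl K) (AddMonoidHom.id K) V}
  {G' : PolarForm (RingEquiv.refl K) (AddMonoidHom.id K) V'}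

lemma val_binary (G : PolarForm (RingEquiv.refl K) (AddMonoidHom.id K) V) (e f : V) (x y : K) :
    G.val (x • e + y • f) = x ^ 2 * G.val e + y ^ 2 * G.val f + x * y * G.bil e f := by
  rw [G.val_add, G.val_smul, G.val_smul, G.bil_smul_left, map_smul]
  simp only [RingEquiv.refl_apply, AddMonoidHom.id_apply, smul_eq_mul]
  ring

lemma bil_self_eq_two_mul (G : PolarForm (RingEquiv.refl K) (AddMonoidHom.id K) V) (e : V) :
    G.bil e e = 2 * G.val e := by
  have h1 := G.val_binary e e 1 1
  rw [← add_smul, G.val_smul] at h1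
  simp only [RingEquiv.refl_apply] at h1
  linear_combination - h1

variable [Finite K]

/-- In an orthogonal basis `e`, `f`, anisotropy says that `-val f / val e` is a nonsquare. It
differs from `d` by a square factor, which rescaling `f` absorbs. -/
lemma Anisotropic.hasBinaryForm_of_two_ne_zero [FiniteDimensional K V] (h2 : (2 : K) ≠ 0)
    (hG : G.Anisotropic) (hV : Module.finrank K V = 2) {d : K} (hd : ¬ IsSquare d) :
    G.HasBinaryForm fun x y => x ^ 2 - d * y ^ 2 := by
  have : Nontrivial V := Module.nontrivial_of_finrank_pos (R := K) (by omega)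
  obtain ⟨e, he⟩ := exists_ne (0 : V)
  obtain ⟨v, hv⟩ := exists_notMem_span_singleton hV.ge e
  have hN : G.val e ≠ 0 := fun h => he (hG e h)
  have hb : G.bil e e ≠ 0 := by
    rw [bil_self_eq_two_mul]
    exact mul_ne_zero h2 hN
  obtain ⟨f, hf, hef⟩ : ∃ f, f ∉ Submodule.span K {e} ∧ G.bil e f = 0 := by
    refine ⟨v - (G.bil e v / G.bil e e) • e, fun h => hv ?_, ?_⟩
    · simpa using add_mem h (Submodule.smul_mem _ (G.bil e v / G.bil e e)
        (Submodule.mem_span_singleton_self e))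
    · rw [map_sub, map_smul, smul_eq_mul, div_mul_cancel₀ _ hb, sub_self]
  have hd' : ¬ IsSquare (- G.val f / G.val e) := by
    rintro ⟨s, hs⟩
    have : s • e + (1 : K) • f = 0 := by
      apply hG
      rw [val_binary, hef]
      field_simp at hs
      linear_combination -hs
    refine hf (Submodule.mem_span_singleton.2 ⟨-s, ?_⟩)
    rw [neg_smul, ← sub_eq_zero, ← neg_eq_zero]
    simpa [add_comm] using this
  obtain ⟨t, ht⟩ := exists_eq_sq_mul_of_not_isSquare h2 hd hd'
  refine ⟨e, t • f, G.val e, hN, rfl, fun x y => ?_⟩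
  rw [smul_smul, val_binary, hef, ht]
  field_simp
  ring

/-- Every element is a square in characteristic two, so orthogonal `e`, `v` would yield a singular
vector. Once `bil e f = val e`, anisotropy keeps `val f / val e` out of the image of `u ↦ u ^ 2 +
u`, and replacing `f` by `f + u • e` shifts this quotient by `u ^ 2 + u`, reaching the prescribed
`c`. -/
lemma Anisotropic.hasBinaryForm_of_two_eq_zero [FiniteDimensional K V] (h2 : (2 : K) = 0)
    (hG : G.Anisotropic) (hV : Module.finrank K V = 2) {c : K} (hc : ∀ u, c ≠ u ^ 2 + u) :
    G.HasBinaryForm fun x y => x ^ 2 + x * y + c * y ^ 2 := by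
  have : Nontrivial V := Module.nontrivial_of_finrank_pos (R := K) (by omega)
  obtain ⟨e, he⟩ := exists_ne (0 : V)
  obtain ⟨v, hv⟩ := exists_notMem_span_singleton hV.ge e
  have hN : G.val e ≠ 0 := fun h => he (hG e h)
  have key : ∀ f, f ∉ Submodule.span K {e} → ∀ s : K, G.val (s • e + (1 : K) • f) ≠ 0 := by
    intro f hf s h
    refine hf (Submodule.mem_span_singleton.2 ⟨-s, ?_⟩)
    have := hG _ h
    rw [neg_smul, ← sub_eq_zero, ← neg_eq_zero]
    simpa [add_comm] using this
  have hb : G.bil e v ≠ 0 := by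
    intro hb
    have hr : ringChar K = 2 := CharP.ringChar_of_prime_eq_zero Nat.prime_two (by simpa using h2)
    obtain ⟨s, hs⟩ := FiniteField.isSquare_of_char_two hr (- G.val v / G.val e)
    refine key v hv s ?_
    rw [val_binary, hb]
    field_simp at hs
    linear_combination -hs
  set f := (G.val e / G.bil e v) • v with hf
  have hef : G.bil e f = G.val e := by
    rw [hf, map_smul, smul_eq_mul, div_mul_cancel₀ _ hb]
  have hfs : f ∉ Submodule.span K {e} := fun h => hv <| by
    have := Submodule.smul_mem _ (G.val e / G.bil e v)⁻¹ h
    rwa [hf, smul_smul, inv_mul_cancel₀ (div_ne_zero hN hb), one_smul] at this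
  have hc' : ∀ u, G.val f / G.val e ≠ u ^ 2 + u := by
    intro u hu
    refine key f hfs u ?_
    rw [val_binary, hef]
    field_simp at hu
    linear_combination hu + G.val e * (u ^ 2 + u) * h2
  obtain ⟨u, hu⟩ := exists_eq_add_sq_add_self h2 hc hc'
  refine ⟨e, f + u • e, G.val e, hN, rfl, fun x y => ?_⟩
  rw [show x • e + y • (f + u • e) = (x + y * u) • e + y • f by module, val_binary, hef, hu]
  field_simp
  linear_combination (G.val e * x * y * u) * h2

lemma Anisotropic.similar_of_finrank_le_two [FiniteDimensional K V] [FiniteDimensional K V']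
    (hG : G.Anisotropic) (hG' : G'.Anisotropic)
    (h : Module.finrank K V = Module.finrank K V') (hV : Module.finrank K V ≤ 2) :
    G.Similar G' := by
  rcases hV.lt_or_eq with hV | hV
  · exact similar_of_finrank_le_one hG hG' h (by omega)
  by_cases h2 : (2 : K) = 0
  · obtain ⟨c, hc⟩ : ∃ c : K, ∀ u, c ≠ u ^ 2 + u := by
      -- Both `0` and `1` map to `0`; on a finite set, failure of injectivity gives failure of
      -- surjectivity.
      have hinj : ¬ Function.Injective fun u : K => u ^ 2 + u := fun hi => by
        have := @hi 0 1 (by linear_combination -h2)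
        exact zero_ne_one this
      have hsurj : ¬ Function.Surjective fun u : K => u ^ 2 + u := fun hs =>
        hinj (Finite.injective_iff_surjective.2 hs)
      simp only [Function.Surjective, not_forall, not_exists] at hsurj
      exact hsurj.imp fun c hc u => Ne.symm (hc u)
    refine (hG.hasBinaryForm_of_two_eq_zero h2 hV hc).similar
      (hG'.hasBinaryForm_of_two_eq_zero h2 (h ▸ hV) hc) (fun x y hxy => ?_) hV (h ▸ hV)
    rcases eq_or_ne y 0 with rfl | hy
    · simpa using hxy
    · refine absurd ?_ (hc (x / y))
      field_simp
      linear_combination hxy - (x ^ 2 + x * y) * h2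
  · obtain ⟨d, hd⟩ := FiniteField.exists_nonsquare (F := K) fun hr =>
      h2 (by exact_mod_cast (ringChar.spec K 2).2 hr.dvd)
    refine (hG.hasBinaryForm_of_two_ne_zero h2 hV hd).similar
      (hG'.hasBinaryForm_of_two_ne_zero h2 (h ▸ hV) hd) (fun x y hxy => ?_) hV (h ▸ hV)
    rcases eq_or_ne y 0 with rfl | hy
    · simpa using hxy
    · refine absurd ⟨x / y, ?_⟩ hd
      field_simp
      linear_combination -hxy

end Quadratic

section Hermitian

/-- Evaluate `val ((1 + a) • x)` by homogeneity and by polarization; the comparison leaves a common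
factor `a + σ a`, which can be chosen nonzero. -/
lemma val_eq_bil_self {G : PolarForm σ (conjTrace σ) V} (hσ : ∀ a, σ (σ a) = a)
    (h1 : σ ≠ RingEquiv.refl K) (x : V) : G.val x = G.bil x x := by
  have hT := isTraceMap_conjTrace hσ h1
  obtain ⟨a, ha⟩ := exists_conjTrace_ne_zero h1
  have e1 := G.val_add x (a • x)
  rw [show x + a • x = (1 + a) • x by rw [add_smul, one_smul], G.val_smul, G.val_smul, map_smul,
    smul_eq_mul, mul_comm a (G.bil x x), hT.map_mul _ _ (G.bil_symm x x), conjTrace_apply, map_add,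
    map_one] at e1
  refine mul_left_cancel₀ ha ?_
  linear_combination e1

/-- For orthogonal `e`, `f` with `val e ≠ 0`, the equation `x * σ x * val e + val f = 0` is solvable
because the norm is onto the fixed field. -/
lemma exists_val_eq_zero_of_two_le_finrank [Finite K] [FiniteDimensional K V]
    (G : PolarForm σ (conjTrace σ) V)
    (hσ : ∀ a, σ (σ a) = a) (h1 : σ ≠ RingEquiv.refl K) (hV : 2 ≤ Module.finrank K V) :
    ∃ x ≠ 0, G.val x = 0 := by
  have : Nontrivial V := Module.nontrivial_of_finrank_pos (R := K) (by omega)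
  obtain ⟨e, he⟩ := exists_ne (0 : V)
  by_cases hN : G.val e = 0
  · exact ⟨e, he, hN⟩
  obtain ⟨v, hv⟩ := exists_notMem_span_singleton hV e
  have hb : G.bil e e ≠ 0 := by rwa [← val_eq_bil_self hσ h1]
  obtain ⟨f, hf, hef⟩ : ∃ f, f ∉ Submodule.span K {e} ∧ G.bil e f = 0 := by
    refine ⟨v - (G.bil e v / G.bil e e) • e, fun h => hv ?_, ?_⟩
    · simpa using add_mem h (Submodule.smul_mem _ (G.bil e v / G.bil e e)
        (Submodule.mem_span_singleton_self e))
    · rw [map_sub, map_smul, smul_eq_mul, div_mul_cancel₀ _ hb, sub_self]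
  obtain ⟨x, hx⟩ := exists_mul_conj_eq hσ h1 (k := - G.val f / G.val e)
    (by rw [map_div₀, map_neg, G.conj_val, G.conj_val])
  refine ⟨x • e + f, fun h => hf (Submodule.mem_span_singleton.2 ⟨-x, ?_⟩), ?_⟩
  · rw [neg_smul]
    exact neg_eq_of_add_eq_zero_right h
  · rw [G.val_add, G.val_smul, G.bil_smul_left, hef, hx]
    field_simp
    simp

end Hermitian

lemma similar_of_finrank_eq_hermitian [Finite K] (hσ : ∀ a, σ (σ a) = a)
    (h1 : σ ≠ RingEquiv.refl K) {V : Type*} {V' : Type*} [AddCommGroup V] [Module K V]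
    [FiniteDimensional K V] [AddCommGroup V'] [Module K V'] [FiniteDimensional K V']
    {G : PolarForm σ (conjTrace σ) V} {G' : PolarForm σ (conjTrace σ) V'}
    (hG : G.Nonsingular) (hG' : G'.Nonsingular)
    (h : Module.finrank K V = Module.finrank K V') : G.Similar G' := by
  obtain ⟨n, hn⟩ : ∃ n, Module.finrank K V = n := ⟨_, rfl⟩
  have hT := isTraceMap_conjTrace hσ h1
  induction n using Nat.strong_induction_on generalizing V V' with
  | _ n ih =>
  by_cases h2 : 2 ≤ n
  · obtain ⟨y, hy0, hy⟩ := G.exists_val_eq_zero_of_two_le_finrank hσ h1 (by omega)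
    obtain ⟨y', hy0', hy'⟩ := G'.exists_val_eq_zero_of_two_le_finrank hσ h1 (by omega)
    obtain ⟨z, hz⟩ := exists_isHyperbolicPair hT hG hy hy0
    obtain ⟨z', hz'⟩ := exists_isHyperbolicPair hT hG' hy' hy0'
    have e1 := hz.finrank_pairPerp hT
    have e2 := hz'.finrank_pairPerp hT
    obtain ⟨φ, c, hc, hσc, hφ, -⟩ := hz.exists_similarity hT hz'
      (ih (n - 2) (by omega) (hz.nonsingular_pairPerp hT hG) (hz'.nonsingular_pairPerp hT hG')
        (by omega) (by omega))
    exact ⟨φ, c, hc, hσc, hφ⟩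
  · exact similar_of_finrank_le_one (hG.anisotropic_of_finrank_le_one hT (by omega))
      (hG'.anisotropic_of_finrank_le_one hT (by omega)) h (by omega)

/-- `r` is the largest dimension of a totally singular subspace. -/
def HasWitt (G : PolarForm σ T V) (r : ℕ) : Prop :=
  (∃ U : Submodule K V, (∀ u ∈ U, G.val u = 0) ∧ Module.finrank K U = r) ∧
    ∀ U : Submodule K V, (∀ u ∈ U, G.val u = 0) → Module.finrank K U ≤ r

lemma HasWitt.anisotropic [FiniteDimensional K V] {G : PolarForm σ T V} (hr : G.HasWitt 0) :
    G.Anisotropic := by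
  intro x hx
  by_contra hx0
  have := hr.2 (Submodule.span K {x}) fun u hu => by
    obtain ⟨a, rfl⟩ := Submodule.mem_span_singleton.1 hu
    exact G.val_smul_eq_zero hx a
  rw [finrank_span_singleton hx0] at this
  omega

lemma HasWitt.exists_val_eq_zero {G : PolarForm σ T V} {r : ℕ} (hr : G.HasWitt (r + 1)) :
    ∃ x ≠ 0, G.val x = 0 := by
  obtain ⟨⟨U, hU, hUr⟩, -⟩ := hr
  obtain ⟨x, hx, hx0⟩ := U.exists_mem_ne_zero_of_ne_bot (by
    rintro rfl
    simp at hUr)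
  exact ⟨x, hx0, hU x hx⟩

/-- Splitting off a hyperbolic plane lowers the Witt index by one. -/
lemma HasWitt.pairPerp [FiniteDimensional K V] {G : PolarForm σ T V} (hT : IsTraceMap σ T) {r : ℕ}
    (hr : G.HasWitt r) {y z : V} (h : G.IsHyperbolicPair y z) :
    ∃ s, r = s + 1 ∧ (G.comap (G.pairPerp y z).subtype).HasWitt s := by
  have hy0 : y ≠ 0 := by
    rintro rfl
    have := h.bil_eq'
    rw [map_zero] at this
    exact zero_ne_one this
  obtain ⟨⟨U, hU, hUr⟩, hmax⟩ := hr
  have hyy := bil_self hT h.val_left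
  -- Adjoining `y` to a totally singular subspace of the complement keeps it totally singular and
  -- raises its dimension by one.
  have hub : ∀ A : Submodule K (G.pairPerp y z),
      (∀ u ∈ A, (G.comap (G.pairPerp y z).subtype).val u = 0) → Module.finrank K A + 1 ≤ r := by
    intro A hA
    have hdisj : A.map (G.pairPerp y z).subtype ⊓ Submodule.span K {y} = ⊥ := by
      rw [Submodule.eq_bot_iff]
      rintro _ ⟨⟨a, ha, rfl⟩, hay⟩
      obtain ⟨t, ht⟩ := Submodule.mem_span_singleton.1 hay
      have h2 := (mem_pairPerp.1 a.2).2
      rw [Submodule.subtype_apply] at ht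
      rw [← ht, map_smul, h.bil_eq', smul_eq_mul, mul_one] at h2
      rw [Submodule.subtype_apply, ← ht, h2, zero_smul]
    have hdim := Submodule.finrank_sup_add_finrank_inf_eq
      (A.map (G.pairPerp y z).subtype) (Submodule.span K {y})
    rw [hdisj, finrank_bot, finrank_span_singleton hy0,
      Submodule.finrank_map_subtype_eq] at hdim
    rw [← hdim, add_zero]
    refine hmax _ fun u hu => ?_
    obtain ⟨_, ⟨a, ha, rfl⟩, b, hb, rfl⟩ := Submodule.mem_sup.1 hu
    obtain ⟨t, rfl⟩ := Submodule.mem_span_singleton.1 hb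
    rw [val_add_smul_of_val_eq_zero hT h.val_left, Submodule.subtype_apply,
      (mem_pairPerp.1 a.2).1, mul_zero, map_zero, add_zero]
    exact hA a ha
  obtain ⟨s, rfl⟩ : ∃ s, r = s + 1 := by
    have := hub ⊥ fun u hu => by
      rw [(Submodule.mem_bot K).1 hu, val_zero]
    exact ⟨r - 1, by omega⟩
  refine ⟨s, rfl, ?_, fun A hA => by have := hub A hA; omega⟩
  -- Conversely, cut a maximal `U` with `y^⊥` (the kernel of `f`) and project along the hyperbolic
  -- plane (`g`); on `y^⊥` the projection preserves `val`.
  let f : U →ₗ[K] K := (G.bil y).domRestrict U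
  let π : V →ₗ[K] G.pairPerp y z := (LinearMap.snd K (K × K) _).comp (h.split hT : V →ₗ[K] _)
  let g : LinearMap.ker f →ₗ[K] G.pairPerp y z :=
    π.comp (U.subtype.comp (LinearMap.ker f).subtype)
  have hdec : ∀ v : V, v = G.bil z v • y + G.bil y v • z + (π v : V) := fun v =>
    ((h.split hT).symm_apply_apply v).symm
  have hval : ∀ v : V, G.bil y v = 0 → G.val (π v) = G.val v := by
    intro v hv
    have := h.val_split_symm hT (h.split hT v)
    rw [LinearEquiv.symm_apply_apply] at this
    rw [this, show (h.split hT v).1.2 = 0 from hv, mul_zero, map_zero, zero_add]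
    rfl
  have hsing : ∀ u ∈ LinearMap.range g, (G.comap (G.pairPerp y z).subtype).val u = 0 := by
    rintro _ ⟨⟨⟨v, hv⟩, hvf⟩, rfl⟩
    exact (hval v hvf).trans (hU v hv)
  refine ⟨LinearMap.range g, hsing, ?_⟩
  have hle := hub _ hsing
  have hf := LinearMap.finrank_range_add_finrank_ker f
  have hg := LinearMap.finrank_range_add_finrank_ker g
  have hf1 : Module.finrank K (LinearMap.range f) ≤ 1 :=
    (Submodule.finrank_le _).trans (Module.finrank_self K).le
  have hkerg : ∀ v ∈ LinearMap.ker g, (v : U).1 = G.bil z (v : U).1 • y := by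
    rintro ⟨⟨v, hv⟩, hvf⟩ hvg
    have h1 : π v = 0 := hvg
    have h2 : G.bil y v = 0 := hvf
    have := hdec v
    rwa [h1, h2, zero_smul, ZeroMemClass.coe_zero, add_zero, add_zero] at this
  -- At most one dimension is lost in total: if `y ∈ U` then `f = 0` and `ker g` is at most a line;
  -- otherwise `f` costs at most one and `g` is injective.
  by_cases hyU : y ∈ U
  · have hf0 : Module.finrank K (LinearMap.range f) = 0 := by
      have : f = 0 := by
        ext ⟨u, hu⟩
        exact bil_eq_zero_of_forall hT (hU u hu) h.val_left fun a =>
          hU _ (U.add_mem hu (U.smul_mem a hyU))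
      rw [this, LinearMap.range_zero, finrank_bot]
    have hg1 : Module.finrank K (LinearMap.ker g) ≤ 1 :=
      finrank_le_one (R := K) (⟨⟨⟨y, hyU⟩, hyy⟩, by
        change π y = 0
        have := hdec y
        rw [h.bil_eq', hyy, one_smul, zero_smul, add_zero, left_eq_add] at this
        exact Subtype.ext this⟩ : LinearMap.ker g) fun w =>
        ⟨G.bil z ((w : LinearMap.ker f) : U).1, by
          ext
          exact (hkerg _ w.2).symm⟩
    omega
  · have hg0 : Module.finrank K (LinearMap.ker g) = 0 := by
      have : LinearMap.ker g = ⊥ := by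
        rw [Submodule.eq_bot_iff]
        intro v hv
        have h1 := hkerg v hv
        have h2 : G.bil z (v : U).1 = 0 := by
          by_contra hne
          refine hyU ?_
          have h3 := U.smul_mem (G.bil z (v : U).1)⁻¹ (v : U).2
          rwa [h1, map_smul, h.bil_eq', smul_eq_mul, mul_one, smul_smul, inv_mul_cancel₀ hne,
            one_smul] at h3
        ext
        rw [h1, h2, zero_smul]
        rfl
      rw [this, finrank_bot]
    omega

/-- After `r` hyperbolic planes are removed from both forms, the bound `2 * r + 2` leaves
anisotropic forms in dimension at most two, which are classified. -/
lemma similar_of_hasWitt [Finite K] {V : Type*} {V' : Type*} [AddCommGroup V] [Module K V]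
    [FiniteDimensional K V] [AddCommGroup V'] [Module K V'] [FiniteDimensional K V']
    {G : PolarForm (RingEquiv.refl K) (AddMonoidHom.id K) V}
    {G' : PolarForm (RingEquiv.refl K) (AddMonoidHom.id K) V'}
    (hG : G.Nonsingular) (hG' : G'.Nonsingular) {r : ℕ} (hr : G.HasWitt r) (hr' : G'.HasWitt r)
    (h : Module.finrank K V = Module.finrank K V') (hV : Module.finrank K V ≤ 2 * r + 2) :
    G.Similar G' := by
  have hT := isTraceMap_refl (K := K)
  induction r generalizing V V' with
  | zero => exact hr.anisotropic.similar_of_finrank_le_two hr'.anisotropic h hV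
  | succ r ih =>
    obtain ⟨y, hy0, hy⟩ := hr.exists_val_eq_zero
    obtain ⟨y', hy0', hy'⟩ := hr'.exists_val_eq_zero
    obtain ⟨z, hz⟩ := exists_isHyperbolicPair hT hG hy hy0
    obtain ⟨z', hz'⟩ := exists_isHyperbolicPair hT hG' hy' hy0'
    have e1 := hz.finrank_pairPerp hT
    have e2 := hz'.finrank_pairPerp hT
    obtain ⟨s, hs, hws⟩ := hr.pairPerp hT hz
    obtain ⟨s', hs', hws'⟩ := hr'.pairPerp hT hz'
    obtain rfl : r = s := by omega
    obtain rfl : r = s' := by omega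
    obtain ⟨φ, c, hc, hσc, hφ, -⟩ := hz.exists_similarity hT hz'
      (ih (hz.nonsingular_pairPerp hT hG) (hz'.nonsingular_pairPerp hT hG') hws hws'
        (by omega) (by omega))
    exact ⟨φ, c, hc, hσc, hφ⟩

end PolarForm

/-! ### Types of forms -/

/-- The pairs of a conjugation and a trace map that belong to the forms of a given type. -/
def PolarType.Compatible {K : Type*} [Field K] (σ : K ≃+* K) (T : K →+ K) : PolarType → Prop
  | .hermitian => (∀ a, σ (σ a) = a) ∧ σ ≠ RingEquiv.refl K ∧ T = conjTrace σ
  | _ => σ = RingEquiv.refl K ∧ T = AddMonoidHom.id K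

namespace PolarType.Compatible

variable {K : Type*} [Field K] {σ τ : K ≃+* K} {T S : K →+ K} {t : PolarType}

lemma isTraceMap (h : t.Compatible σ T) : IsTraceMap σ T := by
  cases t with
  | hermitian =>
    obtain ⟨h1, h2, rfl⟩ := h
    exact isTraceMap_conjTrace h1 h2
  | _ =>
    obtain ⟨rfl, rfl⟩ := h
    exact isTraceMap_refl

/-- This lets the forms on the various cone bases, each given with its own conjugation, be compared
with the form on the whole space. -/
lemma unique [Finite K] (h : t.Compatible σ T) (h' : t.Compatible τ S) : σ = τ ∧ T = S := by
  cases t with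
  | hermitian =>
    obtain ⟨h1, h2, rfl⟩ := h
    obtain ⟨h1', h2', rfl⟩ := h'
    obtain rfl := involution_unique h1 h2 h1' h2'
    exact ⟨rfl, rfl⟩
  | _ =>
    obtain ⟨rfl, rfl⟩ := h
    obtain ⟨rfl, rfl⟩ := h'
    exact ⟨rfl, rfl⟩

end PolarType.Compatible

namespace PolarForm

variable {K : Type*} [Field K] {σ : K ≃+* K} {T : K →+ K}
  {V V' : Type*} [AddCommGroup V] [Module K V] [AddCommGroup V'] [Module K V']

/-- The type of a form, in terms of its Witt index. -/
def HasType (G : PolarForm σ T V) : PolarType → Prop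
  | .hyperbolic => ∃ r, G.HasWitt r ∧ Module.finrank K V = 2 * r
  | .parabolic => ∃ r, G.HasWitt r ∧ Module.finrank K V = 2 * r + 1
  | .elliptic => ∃ r, G.HasWitt r ∧ Module.finrank K V = 2 * r + 2
  | .hermitian => True

/-- The dimension drops by two and the Witt index by one, so their offset, which defines the type,
is unchanged. -/
lemma HasType.pairPerp [FiniteDimensional K V] {G : PolarForm σ T V} {t : PolarType}
    (hT : IsTraceMap σ T) (ht : G.HasType t) {y z : V} (h : G.IsHyperbolicPair y z) :
    (G.comap (G.pairPerp y z).subtype).HasType t := by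
  have hfin := h.finrank_pairPerp hT
  cases t with
  | hermitian => trivial
  | _ =>
    obtain ⟨r, hr, hdim⟩ := ht
    obtain ⟨s, rfl, hs⟩ := hr.pairPerp hT h
    exact ⟨s, hs, by omega⟩

/-- Non-singular forms of the same type in spaces of the same dimension are similar. -/
lemma HasType.similar [Finite K] [FiniteDimensional K V] [FiniteDimensional K V']
    {G : PolarForm σ T V} {G' : PolarForm σ T V'} {t : PolarType} (hc : t.Compatible σ T)
    (hG : G.Nonsingular) (hG' : G'.Nonsingular) (ht : G.HasType t) (ht' : G'.HasType t)
    (h : Module.finrank K V = Module.finrank K V') : G.Similar G' := by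
  cases t with
  | hermitian =>
    obtain ⟨h1, h2, rfl⟩ := hc
    exact similar_of_finrank_eq_hermitian h1 h2 hG hG' h
  | _ =>
    obtain ⟨rfl, rfl⟩ := hc
    obtain ⟨r, hr, hdim⟩ := ht
    obtain ⟨r', hr', hdim'⟩ := ht'
    obtain rfl : r = r' := by omega
    exact similar_of_hasWitt hG hG' hr hr' h (by omega)

/-- Non-singular forms of the same type in spaces of the same dimension are similar, by a
similarity that carries a given singular vector into another one. -/
lemma HasType.exists_similarity [Finite K] [FiniteDimensional K V] [FiniteDimensional K V']
    {G : PolarForm σ T V} {G' : PolarForm σ T V'} {t : PolarType} (hc : t.Compatible σ T)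
    (hG : G.Nonsingular) (hG' : G'.Nonsingular) (ht : G.HasType t) (ht' : G'.HasType t)
    (h : Module.finrank K V = Module.finrank K V') {y : V} (hy : G.val y = 0) (hy0 : y ≠ 0)
    {y' : V'} (hy' : G'.val y' = 0) (hy0' : y' ≠ 0) :
    ∃ φ : V ≃ₗ[K] V', (∀ x, G'.val (φ x) = 0 ↔ G.val x = 0) ∧ φ y = y' := by
  have hT := hc.isTraceMap
  obtain ⟨z, hz⟩ := exists_isHyperbolicPair hT hG hy hy0
  obtain ⟨z', hz'⟩ := exists_isHyperbolicPair hT hG' hy' hy0'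
  have e1 := hz.finrank_pairPerp hT
  have e2 := hz'.finrank_pairPerp hT
  obtain ⟨φ, c, hc, -, hφ, hy⟩ := hz.exists_similarity hT hz'
    (HasType.similar hc (hz.nonsingular_pairPerp hT hG) (hz'.nonsingular_pairPerp hT hG')
      (ht.pairPerp hT hz) (ht'.pairPerp hT hz') (by omega))
  exact ⟨φ, fun x => by simp [hφ, hc], hy⟩

/-- `G` describes the same points and the same polarity as `F`. -/
structure Realizes (G : PolarForm σ T V) (F : ClassicalForm K V) : Prop where
  mem_points : ∀ p, p ∈ F.points ↔ G.val p.rep = 0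
  perp_eq : ∀ R, F.perp R = LinearMap.ker (G.bil R.rep)

end PolarForm

/-! ### Passage between classical forms and `PolarForm` -/

section Classical

variable {K : Type*} [Field K] {V : Type*} [AddCommGroup V] [Module K V]

/-- A quadratic form as a `PolarForm`. -/
def QuadraticForm.toPolarForm (Q : QuadraticForm K V) :
    PolarForm (RingEquiv.refl K) (AddMonoidHom.id K) V where
  val := Q
  bil := QuadraticMap.polarBilin Q
  val_smul a x := QuadraticMap.map_smul Q a x
  val_add x y := QuadraticMap.map_add Q x y
  bil_symm x y := QuadraticMap.polar_comm Q x y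
  conj_val _ := rfl

/-- A Hermitian form as a `PolarForm`. -/
def HermForm.toPolarForm (h : HermForm K V) : PolarForm h.conj (conjTrace h.conj) V where
  val x := h.form x x
  bil x := h.form x
  val_smul a x := by simp [mul_comm a, mul_assoc]
  val_add x y := by
    rw [conjTrace_apply, h.form_symm]
    simp only [map_add, LinearMap.add_apply]
    ring
  bil_symm := h.form_symm
  conj_val x := h.form_symm x x

/-- The quadratic form of a `PolarForm` with trivial conjugation. -/
def PolarForm.toQuadraticForm (G : PolarForm (RingEquiv.refl K) (AddMonoidHom.id K) V) :
    QuadraticForm K V where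
  toFun := G.val
  toFun_smul := G.val_smul
  exists_companion' := by
    refine ⟨LinearMap.mk₂ K (fun x y => G.bil x y) G.bil_add_left G.bil_smul_left
      (fun x => map_add _) (fun c x => map_smul _ c), fun x y => ?_⟩
    exact G.val_add x y

/-- The Hermitian form of a `PolarForm` with involutory conjugation. -/
def PolarForm.toHermForm {σ : K ≃+* K} (hσ : ∀ a, σ (σ a) = a) (h1 : σ ≠ RingEquiv.refl K)
    (G : PolarForm σ (conjTrace σ) V) : HermForm K V where
  conj := σ
  conj_conj := hσ
  conj_ne_refl := h1
  form :=
    { toFun := G.bil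
      map_add' := fun x y => LinearMap.ext fun z => G.bil_add_left x y z
      map_smul' := fun a x => LinearMap.ext fun z => G.bil_smul_left a x z }
  form_symm := G.bil_symm

lemma ClassicalForm.exists_polarForm (F : ClassicalForm K V) (hF : F.Nonsingular) {t : PolarType}
    (ht : F.HasType t) :
    ∃ (σ : K ≃+* K) (T : K →+ K) (G : PolarForm σ T V),
      t.Compatible σ T ∧ G.Realizes F ∧ G.Nonsingular ∧ G.HasType t := by
  cases F with
  | orthogonal Q =>
    refine ⟨_, _, Q.toPolarForm, ?_, ⟨fun _ => Iff.rfl, fun _ => rfl⟩, hF, ?_⟩ <;>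
      cases t <;> first | exact ht | exact ⟨rfl, rfl⟩ | exact ht.elim
  | unitary h =>
    refine ⟨_, _, h.toPolarForm, ?_, ⟨fun _ => Iff.rfl, fun _ => rfl⟩, fun x _ hx => hF x hx, ?_⟩ <;>
      cases t <;> first | exact ⟨h.conj_conj, h.conj_ne_refl, rfl⟩ | exact ht.elim | trivial

lemma ClassicalForm.exists_polarForm_of_compatible [Finite K] {σ : K ≃+* K} {T : K →+ K}
    {t : PolarType} (hc : t.Compatible σ T) (F : ClassicalForm K V) (hF : F.Nonsingular)
    (ht : F.HasType t) : ∃ G : PolarForm σ T V, G.Realizes F ∧ G.Nonsingular ∧ G.HasType t := by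
  obtain ⟨σ', T', G, hc', hG⟩ := F.exists_polarForm hF ht
  obtain ⟨rfl, rfl⟩ := hc.unique hc'
  exact ⟨G, hG⟩

lemma PolarForm.exists_classicalForm {σ : K ≃+* K} {T : K →+ K} {t : PolarType}
    (hc : t.Compatible σ T) (G : PolarForm σ T V) (hG : G.Nonsingular) (ht : G.HasType t) :
    ∃ F : ClassicalForm K V, F.Nonsingular ∧ F.HasType t ∧ G.Realizes F := by
  cases t with
  | hermitian =>
    obtain ⟨h1, h2, rfl⟩ := hc
    refine ⟨.unitary (G.toHermForm h1 h2), fun x hx => hG x ?_ hx, trivial,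
      fun p => ?_, fun _ => rfl⟩
    · rw [PolarForm.val_eq_bil_self h1 h2]
      exact hx x
    · rw [PolarForm.val_eq_bil_self h1 h2]
      rfl
  | _ =>
    obtain ⟨rfl, rfl⟩ := hc
    have hpol : ∀ x y, QuadraticMap.polar G.toQuadraticForm x y = G.bil x y := by
      intro x y
      have := G.val_add x y
      change G.val (x + y) - G.val x - G.val y = _
      rw [this, AddMonoidHom.id_apply]
      ring
    refine ⟨.orthogonal G.toQuadraticForm,
      fun x hx hxy => hG x hx fun y => by rw [← hpol, hxy], ht, fun p => Iff.rfl, fun R => ?_⟩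
    ext y
    exact (hpol R.rep y).congr_left

end Classical

/-! ### From projective points to vectors; cones as zero sets of pulled-back forms -/

section Vectors

open Projectivization

variable {K : Type*} [Field K] {V : Type*} [AddCommGroup V] [Module K V]

/-- The vectors that span a point of `S`, together with the zero vector. -/
def vectorsOf (S : Set (ℙ K V)) : Set V := {v | ∀ h : v ≠ 0, mk K v h ∈ S}

lemma zero_mem_vectorsOf (S : Set (ℙ K V)) : (0 : V) ∈ vectorsOf S := fun h => absurd rfl h

lemma rep_mem_vectorsOf {S : Set (ℙ K V)} {p : ℙ K V} : p.rep ∈ vectorsOf S ↔ p ∈ S :=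
  ⟨fun h => by simpa using h p.rep_nonzero, fun h _ => by simpa using h⟩

lemma mem_vectorsOf {S : Set (ℙ K V)} {v : V} (hv : v ≠ 0) :
    v ∈ vectorsOf S ↔ mk K v hv ∈ S := ⟨fun h => h hv, fun h _ => h⟩

lemma vectorsOf_injective : Function.Injective (vectorsOf : Set (ℙ K V) → Set V) := by
  intro S S' h
  ext p
  rw [← rep_mem_vectorsOf, h, rep_mem_vectorsOf]

lemma vectorsOf_inter (S S' : Set (ℙ K V)) : vectorsOf (S ∩ S') = vectorsOf S ∩ vectorsOf S' := by
  ext v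
  exact ⟨fun h => ⟨fun hv => (h hv).1, fun hv => (h hv).2⟩, fun h hv => ⟨h.1 hv, h.2 hv⟩⟩

lemma vectorsOf_pointsOf (U : Submodule K V) : vectorsOf (pointsOf U) = U := by
  ext v
  rcases eq_or_ne v 0 with rfl | hv
  · simp [zero_mem_vectorsOf]
  · rw [mem_vectorsOf hv]
    simp [pointsOf, submodule_mk]

lemma mem_pointsOf_iff {U : Submodule K V} {p : ℙ K V} : p ∈ pointsOf U ↔ p.rep ∈ U := by
  rw [← rep_mem_vectorsOf, vectorsOf_pointsOf, SetLike.mem_coe]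

lemma PolarForm.val_rep_mk {σ : K ≃+* K} {T : K →+ K} (G : PolarForm σ T V) {v : V}
    (hv : v ≠ 0) : G.val (Projectivization.mk K v hv).rep = 0 ↔ G.val v = 0 := by
  obtain ⟨a, ha⟩ := exists_smul_eq_mk_rep K v hv
  rw [← ha]
  exact G.val_smul_eq_zero_iff a.ne_zero

lemma PolarForm.Realizes.vectorsOf_points {σ : K ≃+* K} {T : K →+ K} {G : PolarForm σ T V}
    {F : ClassicalForm K V} (h : G.Realizes F) : vectorsOf F.points = {v | G.val v = 0} := by
  ext v
  rcases eq_or_ne v 0 with rfl | hv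
  · simp [zero_mem_vectorsOf, G.val_zero]
  · rw [mem_vectorsOf hv, h.mem_points, G.val_rep_mk]
    rfl

/-- The vectors of a cone with vertex `⟨r⟩` in `π` whose base is a non-singular polar space of type
`t`; `p` is the projection from the vertex to the base. -/
def IsVectorCone (σ : K ≃+* K) (T : K →+ K) (t : PolarType) (r : V) (π : Submodule K V)
    (Z : Set V) : Prop :=
  ∃ (W : Submodule K V) (p : V →ₗ[K] W) (G : PolarForm σ T W), G.Nonsingular ∧ G.HasType t ∧
    p r = 0 ∧ (∀ w : W, p w = w) ∧ Submodule.span K {r} ⊔ W = π ∧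
    Z = {v | v ∈ π ∧ G.val (p v) = 0}

lemma vectorsOf_cone {σ : K ≃+* K} {T : K →+ K} {R : ℙ K V} {W : Submodule K V} {p : V →ₗ[K] W}
    {G : PolarForm σ T W} {F : ClassicalForm K W} (hF : G.Realizes F) (hr : p R.rep = 0)
    (hw : ∀ w : W, p w = w) :
    vectorsOf (cone R (map W.subtype W.injective_subtype '' F.points)) =
      {v | v ∈ R.submodule ⊔ W ∧ G.val (p v) = 0} := by
  ext v
  rcases eq_or_ne v 0 with rfl | hv
  · simp [zero_mem_vectorsOf, G.val_zero]
  rw [mem_vectorsOf hv, R.submodule_eq]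
  constructor
  · rintro (h | h)
    · rw [Set.mem_singleton_iff] at h
      obtain ⟨a, ha⟩ := exists_smul_eq_mk_rep K v hv
      rw [h] at ha
      have hva : v = (a⁻¹ : Kˣ) • R.rep := by rw [← ha, inv_smul_smul]
      refine ⟨Submodule.mem_sup_left (Submodule.mem_span_singleton.2 ⟨_, hva.symm⟩), ?_⟩
      rw [hva, Units.smul_def, map_smul, hr, smul_zero, G.val_zero]
    · obtain ⟨_, ⟨s, hs, rfl⟩, hvs⟩ := Set.mem_iUnion₂.1 h
      have hs' := (hF.mem_points s).1 hs
      rw [lineThrough, ← mem_vectorsOf hv, vectorsOf_pointsOf, R.submodule_eq] at hvs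
      obtain ⟨_, ha, b, hb, rfl⟩ := Submodule.mem_sup.1 hvs
      obtain ⟨a, rfl⟩ := Submodule.mem_span_singleton.1 ha
      rw [← s.mk_rep, map_mk, submodule_mk] at hb
      obtain ⟨b, rfl⟩ := Submodule.mem_span_singleton.1 hb
      refine ⟨add_mem (Submodule.mem_sup_left ha)
        (Submodule.mem_sup_right (W.smul_mem _ s.rep.2)), ?_⟩
      rw [map_add, map_smul, map_smul, hr, Submodule.subtype_apply, hw, smul_zero, zero_add]
      exact G.val_smul_eq_zero hs' b
  · rintro ⟨hvW, hG⟩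
    obtain ⟨_, ha, w, hwW, rfl⟩ := Submodule.mem_sup.1 hvW
    obtain ⟨a, rfl⟩ := Submodule.mem_span_singleton.1 ha
    rw [map_add, map_smul, hr, smul_zero, zero_add, hw ⟨w, hwW⟩] at hG
    by_cases hw0 : w = 0
    · subst hw0
      left
      exact ((mk_eq_mk_iff' K _ _ hv R.rep_nonzero).2 ⟨a, (add_zero _).symm⟩).trans R.mk_rep
    · right
      have hw1 : (⟨w, hwW⟩ : W) ≠ 0 := fun h => hw0 (congrArg Subtype.val h)
      refine Set.mem_iUnion₂.2 ⟨_, ⟨mk K ⟨w, hwW⟩ hw1, ?_, rfl⟩, ?_⟩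
      · rwa [hF.mem_points, G.val_rep_mk]
      · rw [map_mk, lineThrough, ← mem_vectorsOf hv, vectorsOf_pointsOf, R.submodule_eq,
          submodule_mk]
        exact add_mem (Submodule.mem_sup_left ha)
          (Submodule.mem_sup_right (Submodule.mem_span_singleton_self w))

lemma exists_projection {r : V} {W : Submodule K V} (h : Submodule.span K {r} ⊓ W = ⊥) :
    ∃ p : V →ₗ[K] W, p r = 0 ∧ ∀ w : W, p w = w := by
  obtain ⟨U, hrU, hU⟩ := (disjoint_iff.2 h).exists_isCompl
  refine ⟨W.projectionOnto U hU.symm, ?_, fun w => ?_⟩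
  · rw [Submodule.projectionOnto_apply_eq_zero_iff]
    exact hrU (Submodule.mem_span_singleton_self r)
  · exact Submodule.projectionOnto_apply_left hU.symm w

lemma isPolarCone_iff [Finite K] {σ : K ≃+* K} {T : K →+ K} {t : PolarType}
    (hc : t.Compatible σ T) {R : ℙ K V} {π : Submodule K V} {D : Set (ℙ K V)} :
    IsPolarCone t R π D ↔ IsVectorCone σ T t R.rep π (vectorsOf D) := by
  constructor
  · rintro ⟨W, _, hRW, rfl, ⟨_, ⟨F, hF, ht, rfl⟩, rfl⟩, rfl⟩
    rw [R.submodule_eq] at hRW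
    obtain ⟨p, hr, hw⟩ := exists_projection hRW
    obtain ⟨G, hGF, hG, htG⟩ := F.exists_polarForm_of_compatible hc hF ht
    exact ⟨W, p, G, hG, htG, hr, hw, by rw [R.submodule_eq], vectorsOf_cone hGF hr hw⟩
  · rintro ⟨W, p, G, hG, ht, hr, hw, rfl, hD⟩
    obtain ⟨F, hF, htF, hGF⟩ := G.exists_classicalForm hc hG ht
    refine ⟨W, _, ?_, by rw [R.submodule_eq], ⟨_, ⟨F, hF, htF, rfl⟩, rfl⟩,
      vectorsOf_injective ?_⟩
    · rw [R.submodule_eq, Submodule.eq_bot_iff]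
      rintro x ⟨hx, hxW⟩
      obtain ⟨a, rfl⟩ := Submodule.mem_span_singleton.1 hx
      have := hw ⟨_, hxW⟩
      rw [map_smul, hr, smul_zero] at this
      exact congrArg Subtype.val this.symm
    · rw [hD, vectorsOf_cone hGF hr hw, R.submodule_eq]

end Vectors

/-! ### Counting by translation -/

section Counting

variable {K : Type*} [Field K] [Finite K] {V : Type*} [AddCommGroup V] [Module K V] [Finite V]

/-- If every `x ∈ X` has exactly `m` translates `x + a • y` in `Z`, where `X` is invariant under
these translations, then `X ∩ Z` has density `m / |K|` in `X`. -/
lemma ncard_mul_eq_of_translates {X Z : Set V} {y : V} {m : ℕ}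
    (hX : ∀ v ∈ X, ∀ a : K, v + a • y ∈ X)
    (hm : ∀ v ∈ X, {a : K | v + a • y ∈ Z}.ncard = m) :
    X.ncard * m = Nat.card K * (X ∩ Z).ncard := by
  classical
  have := Fintype.ofFinite K
  have := Fintype.ofFinite V
  -- Double count the pairs `(v, a)` with `v + a • y ∈ Z`: for fixed `a`, translation by `a • y`
  -- maps the admissible `v` bijectively onto `X ∩ Z`.
  have key := Finset.card_mul_eq_card_mul (s := X.toFinset) (t := (Finset.univ : Finset K))
    (m := m) (n := (X ∩ Z).ncard) (fun v a => v + a • y ∈ Z) ?_ ?_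
  · rwa [← Set.ncard_eq_toFinset_card', Finset.card_univ, ← Nat.card_eq_fintype_card] at key
  · intro v hv
    rw [← hm v (Set.mem_toFinset.1 hv), Set.ncard_eq_toFinset_card']
    congr 1
    ext a
    simp [Finset.bipartiteAbove]
  · intro a _
    rw [← Set.ncard_coe_finset, ← Set.ncard_image_of_injective _ (add_left_injective (a • y))]
    congr 1
    ext v
    simp only [Finset.coe_bipartiteBelow, Set.mem_toFinset, Set.mem_image, Set.mem_inter_iff]
    constructor
    · rintro ⟨w, ⟨hw, hwZ⟩, rfl⟩
      exact ⟨hX w hw a, hwZ⟩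
    · rintro ⟨hv, hvZ⟩
      have h := hX v hv (-a)
      refine ⟨v + (-a) • y, ⟨h, ?_⟩, ?_⟩ <;> simp [hvZ]

lemma ncard_eq_mul_ncard_inter_ker {S : Set V} {y : V} (hS : ∀ v ∈ S, ∀ a : K, v + a • y ∈ S)
    {l : V →ₗ[K] K} (hl : l y ≠ 0) : S.ncard = Nat.card K * (S ∩ {v | l v = 0}).ncard := by
  rw [← ncard_mul_eq_of_translates (m := 1) hS, mul_one]
  intro v _
  rw [Set.ncard_eq_one]
  refine ⟨- l v / l y, ?_⟩
  ext a
  change l (v + a • y) = 0 ↔ a = - l v / l y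
  rw [map_add, map_smul, smul_eq_mul, eq_div_iff hl, eq_neg_iff_add_eq_zero, add_comm]

variable {σ : K ≃+* K} {T : K →+ K}

/-- On each line `v + a • y` the singular parameters form a set `a₀ + σ (k / bil y v)` with `k ∈ ker
T`, so their number does not depend on `v`. -/
lemma PolarForm.ncard_mul_eq_ncard_singular (hT : IsTraceMap σ T) (G : PolarForm σ T V) {y : V}
    (hy : G.val y = 0) {X : Set V} (hX : ∀ v ∈ X, ∀ a : K, v + a • y ∈ X)
    (hb : ∀ v ∈ X, G.bil y v ≠ 0) :
    X.ncard * Nat.card T.ker = Nat.card K * (X ∩ {v | G.val v = 0}).ncard := by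
  refine ncard_mul_eq_of_translates hX fun v hv => ?_
  obtain ⟨a₀, ha₀⟩ := exists_val_add_smul_eq_zero hT hy (hb v hv)
  rw [val_add_smul_of_val_eq_zero hT hy] at ha₀
  have hinj : Function.Injective fun k : K => a₀ + σ (k / G.bil y v) := fun k k' h => by
    have h1 := σ.injective (add_left_cancel h)
    rwa [div_left_inj' (hb v hv)] at h1
  have hker : Nat.card T.ker = (T.ker : Set K).ncard := Nat.card_coe_set_eq _
  rw [hker, ← Set.ncard_image_of_injective (T.ker : Set K) hinj]
  congr 1
  ext a
  simp only [Set.mem_image, SetLike.mem_coe, AddMonoidHom.mem_ker]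
  change G.val (v + a • y) = 0 ↔ _
  rw [val_add_smul_of_val_eq_zero hT hy]
  constructor
  · intro h
    refine ⟨σ (a - a₀) * G.bil y v, ?_, ?_⟩
    · rw [map_sub, sub_mul, map_sub]
      linear_combination h - ha₀
    · rw [mul_div_cancel_right₀ _ (hb v hv), hT.conj_conj]
      ring
  · rintro ⟨k, hk, rfl⟩
    rw [map_add, hT.conj_conj, add_mul, div_mul_cancel₀ _ (hb v hv), map_add, hk, add_zero, ha₀]

end Counting

/-! ### Sections of cones through the vertex -/

section Cones

variable {K : Type*} [Field K] {V : Type*} [AddCommGroup V] [Module K V]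
  {r : V} {W π : Submodule K V} {p : V →ₗ[K] W}

lemma exists_eq_smul_add_proj (hr : p r = 0) (hw : ∀ w : W, p w = w)
    (hπ : Submodule.span K {r} ⊔ W = π) {v : V} (hv : v ∈ π) : ∃ a : K, v = a • r + p v := by
  rw [← hπ] at hv
  obtain ⟨_, ha, w, hwW, rfl⟩ := Submodule.mem_sup.1 hv
  obtain ⟨a, rfl⟩ := Submodule.mem_span_singleton.1 ha
  exact ⟨a, by rw [map_add, map_smul, hr, smul_zero, zero_add, hw ⟨w, hwW⟩]⟩

lemma smul_add_mem (hπ : Submodule.span K {r} ⊔ W = π) (a : K) (w : W) : a • r + w ∈ π := by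
  rw [← hπ]
  exact add_mem (Submodule.mem_sup_left (Submodule.smul_mem _ _
    (Submodule.mem_span_singleton_self r))) (Submodule.mem_sup_right w.2)

lemma finrank_eq_finrank_base_add_one [FiniteDimensional K V] (hr0 : r ≠ 0) (hr : p r = 0)
    (hw : ∀ w : W, p w = w) (hπ : Submodule.span K {r} ⊔ W = π) :
    Module.finrank K π = Module.finrank K W + 1 := by
  have hdisj : Submodule.span K {r} ⊓ W = ⊥ := by
    rw [Submodule.eq_bot_iff]
    rintro x ⟨hx, hxW⟩
    obtain ⟨a, rfl⟩ := Submodule.mem_span_singleton.1 hx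
    have := hw ⟨_, hxW⟩
    rw [map_smul, hr, smul_zero] at this
    exact congrArg Subtype.val this.symm
  have h := Submodule.finrank_sup_add_finrank_inf_eq (Submodule.span K {r}) W
  rw [hdisj, finrank_bot, finrank_span_singleton hr0, hπ] at h
  omega

lemma ncard_preimage_proj [Finite K] [Finite V] (hr0 : r ≠ 0) (hr : p r = 0)
    (hw : ∀ w : W, p w = w) (hπ : Submodule.span K {r} ⊔ W = π) (B : Set W) :
    {v | v ∈ π ∧ p v ∈ B}.ncard = Nat.card K * B.ncard := by
  have hp : ∀ (a : K) (w : W), p (a • r + w) = w := fun a w => by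
    rw [map_add, map_smul, hr, smul_zero, zero_add, hw]
  have hinj : Function.Injective fun u : K × W => u.1 • r + (u.2 : V) := by
    rintro ⟨a, w⟩ ⟨b, x⟩ h
    have h1 : w = x := by
      have := congrArg p h
      simpa only [hp] using this
    subst h1
    have h2 : a = b := smul_left_injective K hr0 (add_right_cancel h)
    rw [h2]
  rw [← Set.ncard_univ, ← Set.ncard_prod, ← Set.ncard_image_of_injective _ hinj]
  congr 1
  ext v
  constructor
  · rintro ⟨hv, hvB⟩
    obtain ⟨a, ha⟩ := exists_eq_smul_add_proj hr hw hπ hv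
    exact ⟨(a, p v), ⟨trivial, hvB⟩, ha.symm⟩
  · rintro ⟨⟨a, w⟩, ⟨-, hwB⟩, rfl⟩
    refine ⟨smul_add_mem hπ a w, ?_⟩
    simpa only [hp] using hwB

variable {σ : K ≃+* K} {T : K →+ K} {t : PolarType} {Z Z' : Set V}

lemma IsVectorCone.subset (h : IsVectorCone σ T t r π Z) : Z ⊆ π := by
  obtain ⟨W, p, G, -, -, -, -, -, rfl⟩ := h
  exact fun v hv => hv.1

lemma IsVectorCone.add_smul_mem (h : IsVectorCone σ T t r π Z) {v : V} (hv : v ∈ Z) (a : K) :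
    v + a • r ∈ Z := by
  obtain ⟨W, p, G, -, -, hr, -, hπ, rfl⟩ := h
  refine ⟨add_mem hv.1 ?_, ?_⟩
  · rw [← hπ]
    exact Submodule.mem_sup_left (Submodule.smul_mem _ _ (Submodule.mem_span_singleton_self r))
  · rw [map_add, map_smul, hr, smul_zero, add_zero]
    exact hv.2

/-- Hyperplane sections through the vertex, but not through a given other point, of two cones with
the same vertex in the same space have the same sizes. -/
lemma IsVectorCone.exists_ncard_eq [Finite K] [Finite V] [FiniteDimensional K V]
    (hc : t.Compatible σ T) (hr0 : r ≠ 0) (h : IsVectorCone σ T t r π Z)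
    (h' : IsVectorCone σ T t r π Z') {y : V} (hy : y ∈ Z) (hy' : y ∈ Z')
    (hyr : y ∉ Submodule.span K {r}) {l : V →ₗ[K] K} (hl : l r = 0) :
    ∃ l' : V →ₗ[K] K, l' r = 0 ∧ l' y = l y ∧
      (Z ∩ {v | l v = 0}).ncard = (Z' ∩ {v | l' v = 0}).ncard := by
  obtain ⟨W, p, G, hG, ht, hr, hw, hπ, rfl⟩ := h
  obtain ⟨W', p', G', hG', ht', hr', hw', hπ', rfl⟩ := h'
  have hne : ∀ {U : Submodule K V} {f : V →ₗ[K] U}, f r = 0 → (∀ w : U, f w = w) →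
      Submodule.span K {r} ⊔ U = π → f y ≠ 0 := by
    intro U f h1 h2 h3 h4
    obtain ⟨a, ha⟩ := exists_eq_smul_add_proj h1 h2 h3 hy.1
    rw [h4, ZeroMemClass.coe_zero, add_zero] at ha
    exact hyr (Submodule.mem_span_singleton.2 ⟨a, ha.symm⟩)
  have e1 := finrank_eq_finrank_base_add_one hr0 hr hw hπ
  have e2 := finrank_eq_finrank_base_add_one hr0 hr' hw' hπ'
  obtain ⟨φ, hφ, hφy⟩ := PolarForm.HasType.exists_similarity hc hG hG' ht ht' (by omega)
    hy.2 (hne hr hw hπ) hy'.2 (hne hr' hw' hπ')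
  -- A functional vanishing at the vertex is determined on `π` by its restriction to the base;
  -- carrying that restriction over by `φ` gives `l'`.
  have hlp : ∀ v ∈ π, l v = l (p v) := fun v hv => by
    obtain ⟨a, ha⟩ := exists_eq_smul_add_proj hr hw hπ hv
    conv_lhs => rw [ha]
    rw [map_add, map_smul, hl, smul_zero, zero_add]
  let l' : V →ₗ[K] K := l.comp (W.subtype.comp (φ.symm.toLinearMap.comp p'))
  have hl' : ∀ v, l' v = l (φ.symm (p' v)) := fun v => rfl
  refine ⟨l', by rw [hl', hr']; simp, ?_, ?_⟩
  · rw [hl', ← hφy, φ.symm_apply_apply, ← hlp y hy.1]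
  · let B : Set W := {w | G.val w = 0 ∧ l w = 0}
    let B' : Set W' := {w | G'.val w = 0 ∧ l (φ.symm w) = 0}
    have hB : B' = φ '' B := by
      ext w
      obtain ⟨x, rfl⟩ := φ.surjective w
      rw [φ.injective.mem_set_image]
      change G'.val (φ x) = 0 ∧ l (φ.symm (φ x)) = 0 ↔ G.val x = 0 ∧ l x = 0
      rw [hφ, φ.symm_apply_apply]
    have s1 : {v | v ∈ π ∧ G.val (p v) = 0} ∩ {v | l v = 0} = {v | v ∈ π ∧ p v ∈ B} := by
      ext v
      constructor
      · rintro ⟨⟨h1, h2⟩, h3⟩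
        exact ⟨h1, h2, (hlp v h1).symm.trans h3⟩
      · rintro ⟨h1, h2, h3⟩
        exact ⟨⟨h1, h2⟩, (hlp v h1).trans h3⟩
    have s2 : {v | v ∈ π ∧ G'.val (p' v) = 0} ∩ {v | l' v = 0} = {v | v ∈ π ∧ p' v ∈ B'} := by
      ext v
      exact and_assoc
    rw [s1, s2, ncard_preimage_proj hr0 hr hw hπ, ncard_preimage_proj hr0 hr' hw' hπ', hB,
      Set.ncard_image_of_injective _ φ.injective]

end Cones

/-! ### Pivot families along a totally singular line -/

section Pivot

variable {K : Type*} [Field K] {V : Type*} [AddCommGroup V] [Module K V]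
  {σ : K ≃+* K} {T : K →+ K} {t : PolarType}

namespace PolarForm

/-- The vectors orthogonal to all vectors of `U`. -/
def orthogonal (G : PolarForm σ T V) (U : Submodule K V) : Submodule K V where
  carrier := {v | ∀ u ∈ U, G.bil u v = 0}
  zero_mem' := fun u _ => map_zero _
  add_mem' := fun hv hw u hu => by rw [map_add, hv u hu, hw u hu, add_zero]
  smul_mem' := fun a v hv u hu => by rw [map_smul, hv u hu, smul_zero]

variable {G : PolarForm σ T V} {Λ : Submodule K V}

lemma le_orthogonal (hT : IsTraceMap σ T) (hs : ∀ u ∈ Λ, G.val u = 0) : Λ ≤ G.orthogonal Λ :=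
  fun v hv u hu => bil_eq_zero_of_forall hT (hs v hv) (hs u hu) fun a =>
    hs _ (Λ.add_mem hv (Λ.smul_mem a hu))

end PolarForm

lemma Submodule.exists_eq_smul_add_smul [FiniteDimensional K V] {Λ : Submodule K V}
    (h2 : Module.finrank K Λ = 2) {r y : V} (hr : r ∈ Λ) (hy : y ∈ Λ) (hr0 : r ≠ 0)
    (hyr : y ∉ Submodule.span K {r}) {u : V} (hu : u ∈ Λ) : ∃ a b : K, u = a • r + b • y := by
  have hli : LinearIndependent K ![r, y] := by
    rw [LinearIndependent.pair_iff' hr0]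
    exact fun a h => hyr (Submodule.mem_span_singleton.2 ⟨a, h⟩)
  have hfin := finrank_span_eq_card hli
  have hle : Submodule.span K (Set.range ![r, y]) ≤ Λ := by
    rw [Submodule.span_le]
    rintro _ ⟨i, rfl⟩
    fin_cases i <;> assumption
  rw [← Submodule.eq_of_le_of_finrank_eq hle (by rw [hfin, h2]; rfl), Matrix.range_cons,
    Matrix.range_cons, Matrix.range_empty, Set.union_empty, Set.singleton_union,
    Submodule.mem_span_pair] at hu
  obtain ⟨a, b, h⟩ := hu
  exact ⟨a, b, h.symm⟩

lemma Submodule.exists_mem_notMem_span [FiniteDimensional K V] {Λ : Submodule K V}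
    (h2 : Module.finrank K Λ = 2) (r : V) : ∃ y ∈ Λ, y ∉ Submodule.span K {r} := by
  by_contra! h
  have h1 := Submodule.finrank_mono (show Λ ≤ Submodule.span K {r} from h)
  have h3 := finrank_span_le_card (R := K) ({r} : Set V)
  rw [Set.toFinset_singleton, Finset.card_singleton] at h3
  omega

lemma Projectivization.rep_notMem_span {R S : ℙ K V} (h : R ≠ S) :
    S.rep ∉ Submodule.span K {R.rep} := by
  intro hS
  obtain ⟨a, ha⟩ := Submodule.mem_span_singleton.1 hS
  apply h
  rw [← R.mk_rep, ← S.mk_rep, eq_comm, mk_eq_mk_iff']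
  exact ⟨a, ha⟩

namespace PolarForm

variable {G : PolarForm σ T V} {Λ : Submodule K V}

/-- A family of cones with vertices the points of the totally singular line `Λ`, one in each
tangent hyperplane, which agree with the polar space of `G` on the orthogonal complement of `Λ`. -/
structure IsPivotFamily (G : PolarForm σ T V) (t : PolarType) (Λ : Submodule K V)
    (Z : ℙ K V → Set V) : Prop where
  cone : ∀ R ∈ pointsOf Λ, IsVectorCone σ T t R.rep (LinearMap.ker (G.bil R.rep)) (Z R)
  inter : ∀ R ∈ pointsOf Λ, ∀ v ∈ G.orthogonal Λ, (v ∈ Z R ↔ G.val v = 0)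

variable [FiniteDimensional K V]

lemma mem_orthogonal_iff (h2 : Module.finrank K Λ = 2) {r y : V} (hr : r ∈ Λ) (hy : y ∈ Λ)
    (hr0 : r ≠ 0) (hyr : y ∉ Submodule.span K {r}) {v : V} :
    v ∈ G.orthogonal Λ ↔ G.bil r v = 0 ∧ G.bil y v = 0 := by
  refine ⟨fun h => ⟨h r hr, h y hy⟩, fun h u hu => ?_⟩
  obtain ⟨a, b, rfl⟩ := Submodule.exists_eq_smul_add_smul h2 hr hy hr0 hyr hu
  rw [G.bil_add_left, G.bil_smul_left, G.bil_smul_left, h.1, h.2]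
  simp

lemma mem_orthogonal_of_ne (h2 : Module.finrank K Λ = 2) {R S : ℙ K V} (hR : R ∈ pointsOf Λ)
    (hS : S ∈ pointsOf Λ) (hRS : R ≠ S) {v : V} (hv : G.bil R.rep v = 0)
    (hv' : G.bil S.rep v = 0) : v ∈ G.orthogonal Λ :=
  (mem_orthogonal_iff h2 (mem_pointsOf_iff.1 hR) (mem_pointsOf_iff.1 hS) R.rep_nonzero
    (Projectivization.rep_notMem_span hRS)).2 ⟨hv, hv'⟩

/-- On the part of a cone outside the orthogonal complement of `Λ`, the line `Λ` acts as for the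
original polar space. -/
lemma IsPivotFamily.ncard_mul_eq [Finite K] [Finite V] (hT : IsTraceMap σ T)
    (h2 : Module.finrank K Λ = 2) (hs : ∀ u ∈ Λ, G.val u = 0)
    {Z : ℙ K V → Set V} (hZ : G.IsPivotFamily t Λ Z) {R : ℙ K V} (hR : R ∈ pointsOf Λ)
    {H : Submodule K V} (hH : Λ ≤ H) {X : Set V}
    (hX : X = {v | G.bil R.rep v = 0 ∧ v ∈ H ∧ v ∉ G.orthogonal Λ}) :
    X.ncard * Nat.card T.ker = Nat.card K * (X ∩ Z R).ncard := by
  obtain ⟨W, p, G₀, hG₀, -, hr, hw, hπ, hZR⟩ := hZ.cone R hR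
  have hinter := hZ.inter R hR
  have hRΛ := mem_pointsOf_iff.1 hR
  have hperp := le_orthogonal hT hs
  obtain ⟨y, hy, hyr⟩ := Submodule.exists_mem_notMem_span h2 R.rep
  have hmem := fun v => mem_orthogonal_iff (G := G) h2 hRΛ hy R.rep_nonzero hyr (v := v)
  have hval : ∀ v, v ∈ LinearMap.ker (G.bil R.rep) → ((G₀.comap p).val v = 0 ↔ v ∈ Z R) :=
    fun v hv => by rw [hZR]; exact ⟨fun h => ⟨hv, h⟩, fun h => h.2⟩
  have hξ : ∀ v ∈ G.orthogonal Λ, ((G₀.comap p).val v = 0 ↔ G.val v = 0) := fun v hv => by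
    rw [hval v (hv _ hRΛ), hinter v hv]
  have hy₀ : (G₀.comap p).val y = 0 := (hξ y (hperp hy)).2 (hs y hy)
  -- On `v + K y` the form `G` is constant, so the cone form, having the same zeros on `ξ`, vanishes
  -- there everywhere or nowhere. A nonzero pairing with `y` would produce a zero, hence only zeros,
  -- hence a zero pairing.
  have hξb : ∀ v ∈ G.orthogonal Λ, (G₀.comap p).bil y v = 0 := by
    intro v hv
    by_contra hne
    obtain ⟨a, ha⟩ := exists_val_add_smul_eq_zero hT hy₀ hne
    have hmem' : ∀ b : K, v + b • y ∈ G.orthogonal Λ := fun b =>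
      add_mem hv (Submodule.smul_mem _ b (hperp hy))
    have hconst : ∀ b : K, G.val (v + b • y) = G.val v := fun b => by
      rw [val_add_smul_of_val_eq_zero hT (hs y hy), hv y hy, mul_zero, map_zero, add_zero]
    rw [hξ _ (hmem' a), hconst] at ha
    have hall : ∀ b : K, (G₀.comap p).val (v + b • y) = 0 := fun b => by
      rw [hξ _ (hmem' b), hconst, ha]
    exact hne (bil_eq_zero_of_forall hT ((hξ v hv).2 ha) hy₀ hall)
  -- As `R^⊥` is spanned by `ξ` and any of its vectors `v` outside `ξ`, orthogonality of `y` to `v`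
  -- would put the nonzero singular vector `p y` in the radical of the base form.
  have hbne : ∀ v ∈ X, (G₀.comap p).bil y v ≠ 0 := by
    intro v hv hb
    rw [hX] at hv
    obtain ⟨hvR, -, hvξ⟩ := hv
    have hyv : G.bil y v ≠ 0 := fun h => hvξ ((hmem v).2 ⟨hvR, h⟩)
    have hyR : G.bil R.rep y = 0 := hperp hy _ hRΛ
    have hpy : p y ≠ 0 := fun h => by
      obtain ⟨a, ha⟩ := exists_eq_smul_add_proj hr hw hπ (v := y) hyR
      rw [h, ZeroMemClass.coe_zero, add_zero] at ha
      exact hyr (Submodule.mem_span_singleton.2 ⟨a, ha.symm⟩)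
    refine hpy (hG₀ _ hy₀ fun w => ?_)
    have hwR : G.bil R.rep w = 0 := by
      have := smul_add_mem hπ 0 w
      rwa [zero_smul, zero_add] at this
    have hwξ : (w : V) - (G.bil y w / G.bil y v) • v ∈ G.orthogonal Λ := by
      rw [hmem, map_sub, map_smul, hwR, hvR, smul_zero, sub_zero, map_sub, map_smul, smul_eq_mul,
        div_mul_cancel₀ _ hyv, sub_self]
      exact ⟨rfl, rfl⟩
    have := hξb _ hwξ
    rwa [map_sub, map_smul, hb, smul_zero, sub_zero, comap_bil, hw] at this
  have hXy : ∀ v ∈ X, ∀ a : K, v + a • y ∈ X := by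
    rw [hX]
    rintro v ⟨h1, h3, h4⟩ a
    have hay := Submodule.smul_mem _ a (hperp hy)
    refine ⟨?_, add_mem h3 (H.smul_mem a (hH hy)), fun h => h4 ?_⟩
    · rw [map_add, h1, hay _ hRΛ, add_zero]
    · simpa using sub_mem h hay
  rw [(G₀.comap p).ncard_mul_eq_ncard_singular hT hy₀ hXy hbne]
  congr 2
  ext v
  refine and_congr_right fun hv => hval v ?_
  rw [hX] at hv
  exact hv.1

/-- Both sides have the same density in `(R^⊥ ∩ H) \ ξ`, a set that does not involve the cones. -/
lemma IsPivotFamily.ncard_eq [Finite K] [Finite V] (hT : IsTraceMap σ T)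
    (h2 : Module.finrank K Λ = 2) (hs : ∀ u ∈ Λ, G.val u = 0)
    {Z Z' : ℙ K V → Set V} (hZ : G.IsPivotFamily t Λ Z) (hZ' : G.IsPivotFamily t Λ Z')
    {R : ℙ K V} (hR : R ∈ pointsOf Λ) {H : Submodule K V} (hH : Λ ≤ H) :
    ((Z R ∩ H) \ G.orthogonal Λ).ncard = ((Z' R ∩ H) \ G.orthogonal Λ).ncard := by
  have key : ∀ {Y : ℙ K V → Set V}, G.IsPivotFamily t Λ Y →
      (Y R ∩ H) \ G.orthogonal Λ =
        {v | G.bil R.rep v = 0 ∧ v ∈ H ∧ v ∉ G.orthogonal Λ} ∩ Y R := by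
    intro Y hY
    ext v
    constructor
    · rintro ⟨⟨h1, h3⟩, h4⟩
      exact ⟨⟨(hY.cone R hR).subset h1, h3, h4⟩, h1⟩
    · rintro ⟨⟨-, h3, h4⟩, h1⟩
      exact ⟨⟨h1, h3⟩, h4⟩
  rw [key hZ, key hZ']
  refine Nat.eq_of_mul_eq_mul_left (Nat.card_pos (α := K)) ?_
  rw [← hZ.ncard_mul_eq hT h2 hs hR hH rfl, ← hZ'.ncard_mul_eq hT h2 hs hR hH rfl]

/-- Inside `ξ` every cone coincides with the polar space; outside `ξ` cones with distinct vertices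
are disjoint, since their tangent hyperplanes meet in `ξ`. -/
lemma IsPivotFamily.ncard_iUnion [Finite V] (h2 : Module.finrank K Λ = 2)
    {Z : ℙ K V → Set V} (hZ : G.IsPivotFamily t Λ Z) (H : Submodule K V) :
    ((⋃ R ∈ pointsOf Λ, Z R) ∩ H).ncard =
      {v | v ∈ G.orthogonal Λ ∧ G.val v = 0 ∧ v ∈ H}.ncard +
        ∑ R ∈ (Set.toFinite (pointsOf Λ)).toFinset, ((Z R ∩ H) \ G.orthogonal Λ).ncard := by
  classical
  have := Fintype.ofFinite V
  obtain ⟨r, hr, hr0⟩ := Submodule.exists_mem_notMem_span h2 (0 : V)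
  have hr0' : r ≠ 0 := fun h => hr0 (by rw [h]; exact Submodule.zero_mem _)
  have hR₀ : Projectivization.mk K r hr0' ∈ pointsOf Λ := by
    rwa [← mem_vectorsOf hr0', vectorsOf_pointsOf]
  rw [← Set.ncard_inter_add_ncard_sdiff_eq_ncard _ (G.orthogonal Λ : Set V)]
  congr 1
  · congr 1
    ext v
    constructor
    · rintro ⟨⟨hv, hvH⟩, hvΛ⟩
      obtain ⟨R, hR, hvR⟩ := Set.mem_iUnion₂.1 hv
      exact ⟨hvΛ, (hZ.inter R hR v hvΛ).1 hvR, hvH⟩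
    · rintro ⟨hvΛ, hv, hvH⟩
      exact ⟨⟨Set.mem_iUnion₂.2 ⟨_, hR₀, (hZ.inter _ hR₀ v hvΛ).2 hv⟩, hvH⟩, hvΛ⟩
  · simp only [Set.ncard_eq_toFinset_card']
    rw [← Finset.card_biUnion]
    · congr 1
      ext v
      simp only [Set.mem_toFinset, Finset.mem_biUnion, Set.Finite.mem_toFinset, Set.mem_sdiff,
        Set.mem_inter_iff, Set.mem_iUnion, exists_prop]
      constructor
      · rintro ⟨⟨⟨R, hR, hv⟩, hH⟩, hξ⟩
        exact ⟨R, hR, ⟨hv, hH⟩, hξ⟩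
      · rintro ⟨R, hR, ⟨hv, hH⟩, hξ⟩
        exact ⟨⟨⟨R, hR, hv⟩, hH⟩, hξ⟩
    · intro R hR S hS hRS
      rw [Function.onFun, Finset.disjoint_left]
      intro v hv hv'
      simp only [Set.mem_toFinset, Set.mem_sdiff, Set.mem_inter_iff] at hv hv'
      rw [Finset.mem_coe, Set.Finite.mem_toFinset] at hR hS
      exact hv.2 (mem_orthogonal_of_ne h2 hR hS hRS ((hZ.cone R hR).subset hv.1.1)
        ((hZ.cone S hS).subset hv'.1.1))

/-- The hyperplane sections of one pivot family have the same sizes as hyperplane sections of any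
other. -/
lemma IsPivotFamily.exists_ncard_eq [Finite K] [Finite V] (hc : t.Compatible σ T)
    (h2 : Module.finrank K Λ = 2) (hs : ∀ u ∈ Λ, G.val u = 0)
    {Z Z' : ℙ K V → Set V} (hZ : G.IsPivotFamily t Λ Z) (hZ' : G.IsPivotFamily t Λ Z')
    {l : V →ₗ[K] K} (hl : l ≠ 0) :
    ∃ l' : V →ₗ[K] K, l' ≠ 0 ∧
      ((⋃ R ∈ pointsOf Λ, Z R) ∩ LinearMap.ker l).ncard =
        ((⋃ R ∈ pointsOf Λ, Z' R) ∩ LinearMap.ker l').ncard := by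
  have hT := hc.isTraceMap
  have hperp := le_orthogonal hT hs
  simp only [hZ.ncard_iUnion h2, hZ'.ncard_iUnion h2]
  by_cases hΛ : Λ ≤ LinearMap.ker l
  · refine ⟨l, hl, ?_⟩
    congr 1
    refine Finset.sum_congr rfl fun R hR => ?_
    exact hZ.ncard_eq hT h2 hs hZ' ((Set.Finite.mem_toFinset _).1 hR) hΛ
  obtain ⟨y, hy, hly⟩ := SetLike.not_le_iff_exists.1 hΛ
  rw [LinearMap.mem_ker] at hly
  have hy0 : y ≠ 0 := fun h => hly (by rw [h, map_zero])
  obtain ⟨x, hx, hxy⟩ := Submodule.exists_mem_notMem_span h2 y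
  -- This combination spans the point `R₀` in which the hyperplane meets `Λ`.
  have hr0 : x - (l x / l y) • y ≠ 0 := fun h =>
    hxy (Submodule.mem_span_singleton.2 ⟨_, (sub_eq_zero.1 h).symm⟩)
  let R₀ : ℙ K V := Projectivization.mk K _ hr0
  have hR₀ : R₀ ∈ pointsOf Λ := by
    rw [← mem_vectorsOf hr0, vectorsOf_pointsOf]
    exact sub_mem hx (Λ.smul_mem _ hy)
  have hlR₀ : l R₀.rep = 0 := by
    obtain ⟨a, ha⟩ := Projectivization.exists_smul_eq_mk_rep K _ hr0
    rw [← ha, Units.smul_def, map_smul, map_sub, map_smul, smul_eq_mul, smul_eq_mul,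
      div_mul_cancel₀ _ hly, sub_self, mul_zero]
  have hyR₀ : y ∉ Submodule.span K {R₀.rep} := fun h => by
    obtain ⟨a, ha⟩ := Submodule.mem_span_singleton.1 h
    rw [← ha, map_smul, hlR₀, smul_zero] at hly
    exact hly rfl
  obtain ⟨l', hl'R₀, hl'y, hcard⟩ := (hZ.cone R₀ hR₀).exists_ncard_eq hc R₀.rep_nonzero
    (hZ'.cone R₀ hR₀) ((hZ.inter R₀ hR₀ y (hperp hy)).2 (hs y hy))
    ((hZ'.inter R₀ hR₀ y (hperp hy)).2 (hs y hy)) hyR₀ hlR₀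
  have hl'y0 : l' y ≠ 0 := by rwa [hl'y]
  -- The singular vectors of `ξ` are invariant under translation by `y`, and neither `l` nor `l'`
  -- kills `y`, so each kernel takes a fraction `1/|K|` of them.
  have hξ : {v | v ∈ G.orthogonal Λ ∧ G.val v = 0 ∧ v ∈ LinearMap.ker l}.ncard =
      {v | v ∈ G.orthogonal Λ ∧ G.val v = 0 ∧ v ∈ LinearMap.ker l'}.ncard := by
    have hS : ∀ v ∈ {v | v ∈ G.orthogonal Λ ∧ G.val v = 0}, ∀ a : K,
        v + a • y ∈ {v | v ∈ G.orthogonal Λ ∧ G.val v = 0} := by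
      rintro v ⟨h1, h3⟩ a
      refine ⟨add_mem h1 (Submodule.smul_mem _ a (hperp hy)), ?_⟩
      rw [val_add_smul_of_val_eq_zero hT (hs y hy), h1 y hy, mul_zero, map_zero, add_zero, h3]
    have e1 := ncard_eq_mul_ncard_inter_ker hS hly
    rw [ncard_eq_mul_ncard_inter_ker hS hl'y0] at e1
    have e2 := Nat.eq_of_mul_eq_mul_left Nat.card_pos e1
    have e3 : ∀ m : V →ₗ[K] K, {v | v ∈ G.orthogonal Λ ∧ G.val v = 0 ∧ v ∈ LinearMap.ker m} =
        {v | v ∈ G.orthogonal Λ ∧ G.val v = 0} ∩ {v | m v = 0} := fun m => by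
      ext v
      exact and_assoc.symm
    rw [e3, e3, e2]
  refine ⟨l', fun h => hl'y0 (by rw [h, LinearMap.zero_apply]), ?_⟩
  rw [hξ]
  congr 1
  refine Finset.sum_congr rfl fun R hR => ?_
  rw [Set.Finite.mem_toFinset] at hR
  by_cases hRR : R = R₀
  · subst hRR
    -- At `R₀` the similarity equates whole sections of the cones; removing the equal parts in `ξ`
    -- leaves the parts outside.
    have key : ∀ {Y : ℙ K V → Set V}, G.IsPivotFamily t Λ Y → ∀ m : V →ₗ[K] K,
        (Y R₀ ∩ {v | m v = 0}).ncard =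
          {v | v ∈ G.orthogonal Λ ∧ G.val v = 0 ∧ v ∈ LinearMap.ker m}.ncard +
            ((Y R₀ ∩ LinearMap.ker m) \ G.orthogonal Λ).ncard := by
      intro Y hY m
      rw [← Set.ncard_inter_add_ncard_sdiff_eq_ncard _ (G.orthogonal Λ : Set V)]
      congr 2
      ext v
      constructor
      · rintro ⟨⟨h1, h3⟩, h4⟩
        exact ⟨h4, (hY.inter _ hR v h4).1 h1, h3⟩
      · rintro ⟨h4, h1, h3⟩
        exact ⟨⟨(hY.inter _ hR v h4).2 h1, h3⟩, h4⟩
    rw [key hZ, key hZ', hξ] at hcard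
    exact Nat.add_left_cancel hcard
  · have hRΛ := mem_pointsOf_iff.1 hR
    obtain ⟨a, b, hab⟩ := Submodule.exists_eq_smul_add_smul h2 (mem_pointsOf_iff.1 hR₀) hy
      R₀.rep_nonzero hyR₀ hRΛ
    have hb : b ≠ 0 := fun h => Projectivization.rep_notMem_span (Ne.symm hRR)
      (Submodule.mem_span_singleton.2 ⟨a, by rw [hab, h, zero_smul, add_zero]⟩)
    have key : ∀ {Y : ℙ K V → Set V}, G.IsPivotFamily t Λ Y → ∀ m : V →ₗ[K] K, m R₀.rep = 0 →
        m y ≠ 0 → (Y R \ G.orthogonal Λ).ncard =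
          Nat.card K * ((Y R ∩ LinearMap.ker m) \ G.orthogonal Λ).ncard := by
      intro Y hY m hm hmy
      have hmR : m R.rep ≠ 0 := by
        rw [hab, map_add, map_smul, map_smul, hm, smul_zero, zero_add]
        exact mul_ne_zero hb hmy
      rw [ncard_eq_mul_ncard_inter_ker (y := R.rep) (l := m) ?_ hmR]
      · congr 2
        ext v
        exact and_right_comm
      · rintro v ⟨h1, h3⟩ c
        refine ⟨(hY.cone R hR).add_smul_mem h1 c, fun h => h3 ?_⟩
        simpa using sub_mem h (Submodule.smul_mem _ c (hperp hRΛ))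
    -- Taking the whole space for `H` compares the uncut cones outside `ξ`; each section is a
    -- fraction `1/|K|` of these, as neither functional vanishes at `R`.
    have e1 := hZ.ncard_eq hT h2 hs hZ' hR (le_top : Λ ≤ ⊤)
    rw [Submodule.top_coe, Set.inter_univ, Set.inter_univ, key hZ l hlR₀ hly,
      key hZ' l' hl'R₀ hl'y0] at e1
    exact Nat.eq_of_mul_eq_mul_left Nat.card_pos e1

end PolarForm

end Pivot

/-! ### Return to point sets; tangent cones of the polar space -/

section Points

open Projectivization

variable {K : Type*} [Field K] {V : Type*} [AddCommGroup V] [Module K V]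

lemma ncard_vectorsOf [Finite K] [Finite V] (S : Set (ℙ K V)) :
    (vectorsOf S).ncard = S.ncard * Nat.card Kˣ + 1 := by
  have hinj : Function.Injective fun u : ℙ K V × Kˣ => u.2 • u.1.rep := by
    rintro ⟨p, a⟩ ⟨p', a'⟩ h
    have hp : p = p' := by
      rw [← p.mk_rep, ← p'.mk_rep, mk_eq_mk_iff]
      refine ⟨a⁻¹ * a', ?_⟩
      rw [mul_smul, ← show a • p.rep = a' • p'.rep from h, inv_smul_smul]
    subst hp
    have ha : a = a' := Units.ext (smul_left_injective K p.rep_nonzero h)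
    rw [ha]
  have himg : vectorsOf S =
      insert 0 ((fun u : ℙ K V × Kˣ => u.2 • u.1.rep) '' (S ×ˢ Set.univ)) := by
    ext v
    constructor
    · intro h
      rcases eq_or_ne v 0 with rfl | hv
      · exact Set.mem_insert _ _
      · obtain ⟨a, ha⟩ := exists_smul_eq_mk_rep K v hv
        exact Or.inr ⟨(mk K v hv, a⁻¹), ⟨h hv, trivial⟩, by simp [← ha]⟩
    · rintro (rfl | ⟨⟨p, a⟩, ⟨hp, -⟩, rfl⟩)
      · exact zero_mem_vectorsOf S
      · intro h
        have : mk K (a • p.rep) h = p :=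
          ((mk_eq_mk_iff K _ _ h p.rep_nonzero).2 ⟨a, rfl⟩).trans p.mk_rep
        rw [this]
        exact hp
  rw [himg, Set.ncard_insert_of_notMem, Set.ncard_image_of_injective _ hinj, Set.ncard_prod,
    Set.ncard_univ]
  rintro ⟨⟨p, a⟩, -, h⟩
  exact p.rep_nonzero ((smul_eq_zero_iff_eq a).1 h)

lemma ncard_eq_of_ncard_vectorsOf_eq [Finite K] [Finite V] {S S' : Set (ℙ K V)}
    (h : (vectorsOf S).ncard = (vectorsOf S').ncard) : S.ncard = S'.ncard := by
  rw [ncard_vectorsOf, ncard_vectorsOf] at h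
  exact Nat.eq_of_mul_eq_mul_right Nat.card_pos (Nat.add_right_cancel h)

lemma ncard_pointsOf_of_finrank_eq_two [Finite K] {Λ : Submodule K V}
    (h : Module.finrank K Λ = 2) : (pointsOf Λ).ncard = Nat.card K + 1 := by
  rw [← card_of_finrank_two K Λ h, ← Set.ncard_univ,
    ← Set.ncard_image_of_injective _ (map_injective Λ.subtype Λ.injective_subtype)]
  congr 1
  ext p
  rw [mem_pointsOf_iff]
  constructor
  · intro hp
    refine ⟨mk K ⟨p.rep, hp⟩ fun h => p.rep_nonzero (congrArg Subtype.val h), trivial, ?_⟩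
    rw [map_mk]
    exact p.mk_rep
  · rintro ⟨s, -, rfl⟩
    rw [← mem_pointsOf_iff, ← s.mk_rep, map_mk, pointsOf, Set.mem_ofPred, submodule_mk,
      Submodule.span_singleton_le_iff_mem]
    exact s.rep.2

lemma vectorsOf_biUnion {L : Set (ℙ K V)} (hL : L.Nonempty) (D : ℙ K V → Set (ℙ K V)) :
    vectorsOf (⋃ R ∈ L, D R) = ⋃ R ∈ L, vectorsOf (D R) := by
  ext v
  rcases eq_or_ne v 0 with rfl | hv
  · obtain ⟨R, hR⟩ := hL
    exact iff_of_true (zero_mem_vectorsOf _) (Set.mem_iUnion₂.2 ⟨R, hR, zero_mem_vectorsOf _⟩)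
  · rw [mem_vectorsOf hv]
    simp only [Set.mem_iUnion, mem_vectorsOf hv]

lemma isCoatom_ker {l : V →ₗ[K] K} (hl : l ≠ 0) : IsCoatom (LinearMap.ker l) :=
  LinearMap.isCoatom_ker_of_surjective (LinearMap.surjective hl)

lemma IsCoatom.exists_eq_ker {H : Submodule K V} (hH : IsCoatom H) :
    ∃ l : V →ₗ[K] K, l ≠ 0 ∧ H = LinearMap.ker l := by
  obtain ⟨l, hl, hle⟩ := H.exists_le_ker_of_lt_top hH.lt_top
  exact ⟨l, hl, ((hH.le_iff_eq (isCoatom_ker hl).1).1 hle).symm⟩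

variable {σ : K ≃+* K} {T : K →+ K} {t : PolarType} {G : PolarForm σ T V}

namespace PolarForm

lemma IsPivotFamily.hyperplaneSizes_subset [Finite K] [Finite V] [FiniteDimensional K V]
    (hc : t.Compatible σ T) {Λ : Submodule K V} (h2 : Module.finrank K Λ = 2)
    (hs : ∀ u ∈ Λ, G.val u = 0) (hL : (pointsOf Λ).Nonempty) {D D' : ℙ K V → Set (ℙ K V)}
    (hD : G.IsPivotFamily t Λ fun R => vectorsOf (D R))
    (hD' : G.IsPivotFamily t Λ fun R => vectorsOf (D' R)) :
    hyperplaneSizes (⋃ R ∈ pointsOf Λ, D R) ⊆ hyperplaneSizes (⋃ R ∈ pointsOf Λ, D' R) := by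
  rintro _ ⟨H, hH, rfl⟩
  obtain ⟨l, hl, rfl⟩ := hH.exists_eq_ker
  obtain ⟨l', hl', h⟩ := hD.exists_ncard_eq hc h2 hs hD' hl
  refine ⟨LinearMap.ker l', isCoatom_ker hl', ncard_eq_of_ncard_vectorsOf_eq ?_⟩
  rw [vectorsOf_inter, vectorsOf_inter, vectorsOf_pointsOf, vectorsOf_pointsOf,
    vectorsOf_biUnion hL, vectorsOf_biUnion hL, h]

/-- The tangent hyperplane section at a singular point is a cone over a polar space of the same
type. -/
lemma isVectorCone_tangent [FiniteDimensional K V] (hc : t.Compatible σ T) (hG : G.Nonsingular)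
    (ht : G.HasType t) {r : V} (hr : G.val r = 0) (hr0 : r ≠ 0) :
    IsVectorCone σ T t r (LinearMap.ker (G.bil r)) {v | G.bil r v = 0 ∧ G.val v = 0} := by
  have hT := hc.isTraceMap
  obtain ⟨z, h⟩ := exists_isHyperbolicPair hT hG hr hr0
  let p : V →ₗ[K] G.pairPerp r z := (LinearMap.snd K (K × K) _).comp (h.split hT : V →ₗ[K] _)
  have hdec : ∀ v : V, v = G.bil z v • r + G.bil r v • z + (p v : V) := fun v =>
    ((h.split hT).symm_apply_apply v).symm
  have hpr : p r = 0 := congrArg Prod.snd (h.split_apply_left hT)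
  refine ⟨G.pairPerp r z, p, G.comap (G.pairPerp r z).subtype, h.nonsingular_pairPerp hT hG,
    ht.pairPerp hT h, hpr, fun w => ?_, ?_, ?_⟩
  · have h1 := hdec w
    rw [(mem_pairPerp.1 w.2).1, (mem_pairPerp.1 w.2).2, zero_smul, zero_smul, zero_add,
      zero_add] at h1
    exact Subtype.ext h1.symm
  · apply le_antisymm
    · refine sup_le ?_ inf_le_left
      rw [Submodule.span_singleton_le_iff_mem]
      exact bil_self hT hr
    · intro v hv
      rw [hdec v, LinearMap.mem_ker.1 hv, zero_smul, add_zero]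
      exact add_mem (Submodule.mem_sup_left (Submodule.smul_mem _ _
        (Submodule.mem_span_singleton_self r))) (Submodule.mem_sup_right (p v).2)
  · ext v
    refine and_congr_right fun hv => ?_
    conv_lhs => rw [hdec v, hv, zero_smul, add_zero, add_comm,
      val_add_smul_of_val_eq_zero hT hr, (mem_pairPerp.1 (p v).2).1, mul_zero, map_zero, add_zero]
    rfl

/-- Every vector is orthogonal to a point of a given line. -/
lemma exists_mem_pointsOf_bil_eq_zero (hT : IsTraceMap σ T) [FiniteDimensional K V]
    {Λ : Submodule K V} (h2 : Module.finrank K Λ = 2) (v : V) :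
    ∃ R ∈ pointsOf Λ, G.bil R.rep v = 0 := by
  suffices ∃ u ∈ Λ, u ≠ 0 ∧ G.bil u v = 0 by
    obtain ⟨u, hu, hu0, huv⟩ := this
    refine ⟨Projectivization.mk K u hu0, by rwa [← mem_vectorsOf hu0, vectorsOf_pointsOf], ?_⟩
    obtain ⟨a, ha⟩ := exists_smul_eq_mk_rep K u hu0
    rw [← ha, Units.smul_def, G.bil_smul_left, huv, mul_zero]
  obtain ⟨x, hx, hx0⟩ := Submodule.exists_mem_notMem_span h2 (0 : V)
  obtain ⟨y, hy, hyx⟩ := Submodule.exists_mem_notMem_span h2 x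
  by_cases hxv : G.bil x v = 0
  · exact ⟨x, hx, fun h => hx0 (by rw [h]; exact Submodule.zero_mem _), hxv⟩
  -- The coefficient carries `σ` because `bil` is `σ`-semilinear in its first argument and `σ` is an
  -- involution.
  · refine ⟨y - σ (G.bil y v / G.bil x v) • x, sub_mem hy (Λ.smul_mem _ hx), fun h => hyx
      (Submodule.mem_span_singleton.2 ⟨_, (sub_eq_zero.1 h).symm⟩), ?_⟩
    rw [sub_eq_add_neg, ← neg_smul, G.bil_add_left, G.bil_smul_left, map_neg, hT.conj_conj,
      neg_mul, div_mul_cancel₀ _ hxv, add_neg_cancel]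

/-- Functionals with equal kernels are proportional, so some `S - c R` would be a singular vector in
the radical, hence zero, making the two points equal. -/
lemma injOn_ker_bil (hT : IsTraceMap σ T) (hG : G.Nonsingular) {Λ : Submodule K V}
    (hs : ∀ u ∈ Λ, G.val u = 0) :
    Set.InjOn (fun R : ℙ K V => LinearMap.ker (G.bil R.rep)) (pointsOf Λ) := by
  intro R hR S hS h
  by_contra hne
  have hRΛ := mem_pointsOf_iff.1 hR
  have hSΛ := mem_pointsOf_iff.1 hS
  have hRS : ∀ v, G.bil R.rep v = 0 ↔ G.bil S.rep v = 0 := fun v => by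
    simpa using SetLike.ext_iff.1 h v
  obtain ⟨z, hz⟩ : ∃ z, G.bil R.rep z ≠ 0 := by
    by_contra! hall
    exact R.rep_nonzero (hG _ (hs _ hRΛ) hall)
  let c := σ (G.bil S.rep z / G.bil R.rep z)
  have hrad : S.rep + (-c) • R.rep = 0 := by
    refine hG _ (hs _ (add_mem hSΛ (Λ.smul_mem _ hRΛ))) fun v => ?_
    have h0 : G.bil S.rep (v - (G.bil R.rep v / G.bil R.rep z) • z) = 0 := by
      rw [← hRS, map_sub, map_smul, smul_eq_mul, div_mul_cancel₀ _ hz, sub_self]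
    rw [map_sub, map_smul, smul_eq_mul] at h0
    rw [G.bil_add_left, G.bil_smul_left, map_neg, hT.conj_conj, ← h0]
    field_simp
    ring
  refine rep_notMem_span hne (Submodule.mem_span_singleton.2 ⟨c, ?_⟩)
  rw [neg_smul, ← sub_eq_add_neg, sub_eq_zero] at hrad
  exact hrad.symm

end PolarForm

end Points

/-! ### The theorem -/

theorem mainTheorem5 {K V : Type*} [Field K] [Finite K] [AddCommGroup V] [Module K V]
    [FiniteDimensional K V] (t : PolarType) (F : ClassicalForm K V)
    (hF : F.Nonsingular) (ht : F.HasType t)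
    (P Q : ℙ K V) (hPQ : P ≠ Q) (hcol : lineThrough P Q ⊆ F.points)
    (D : ℙ K V → Set (ℙ K V))
    (hD : ∀ R ∈ lineThrough P Q, IsPolarCone t R (F.perp R) (D R))
    (hξ : ∀ R ∈ lineThrough P Q,
      D R ∩ pointsOf (F.perp P ⊓ F.perp Q) =
        pointsOf (F.perp R) ∩ F.points ∩ pointsOf (F.perp P ⊓ F.perp Q)) :
    IsQuasiPolarSpace t (⋃ R ∈ lineThrough P Q, D R) ∧
      (lineThrough P Q).ncard = Nat.card K + 1 ∧
      Set.InjOn F.perp (lineThrough P Q) ∧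
      ∀ R ∈ lineThrough P Q,
        IsCoatom (F.perp R) ∧
        IsPolarCone t R (F.perp R) (F.points ∩ pointsOf (F.perp R)) ∧
        (⋃ S ∈ lineThrough P Q, D S) ∩ pointsOf (F.perp R) = D R := by
  have : Finite V := Module.finite_of_finite K
  obtain ⟨σ, T, G, hc, hGF, hG, htG⟩ := F.exists_polarForm hF ht
  have hT := hc.isTraceMap
  let Λ := P.submodule ⊔ Q.submodule
  have hline : lineThrough P Q = pointsOf Λ := rfl
  rw [hline] at hcol hD hξ ⊢
  have hP : P ∈ pointsOf Λ := show P.submodule ≤ Λ from le_sup_left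
  have hQ : Q ∈ pointsOf Λ := show Q.submodule ≤ Λ from le_sup_right
  have h2 : Module.finrank K Λ = 2 := by
    have hdisj : P.submodule ⊓ Q.submodule = ⊥ := by
      rw [Submodule.eq_bot_iff, P.submodule_eq, Q.submodule_eq]
      rintro x ⟨hx, hxQ⟩
      obtain ⟨a, rfl⟩ := Submodule.mem_span_singleton.1 hx
      by_contra hne
      have ha : a ≠ 0 := fun h => hne (by rw [h, zero_smul])
      refine Projectivization.rep_notMem_span hPQ.symm ?_
      simpa [smul_smul, ha] using Submodule.smul_mem _ a⁻¹ hxQ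
    have h := Submodule.finrank_sup_add_finrank_inf_eq P.submodule Q.submodule
    rw [hdisj, finrank_bot, P.finrank_submodule, Q.finrank_submodule] at h
    exact h
  have hs : ∀ u ∈ Λ, G.val u = 0 := by
    intro u hu
    have : u ∈ vectorsOf F.points := fun hu0 => hcol <| by
      rwa [← mem_vectorsOf hu0, vectorsOf_pointsOf]
    rwa [hGF.vectorsOf_points] at this
  have horth : F.perp P ⊓ F.perp Q = G.orthogonal Λ := by
    ext v
    rw [PolarForm.mem_orthogonal_iff h2 (mem_pointsOf_iff.1 hP) (mem_pointsOf_iff.1 hQ)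
      P.rep_nonzero (Projectivization.rep_notMem_span hPQ), hGF.perp_eq, hGF.perp_eq]
    rfl
  have hpiv : G.IsPivotFamily t Λ fun R => vectorsOf (D R) := by
    refine ⟨fun R hR => ?_, fun R hR v hv => ?_⟩
    · rw [← isPolarCone_iff hc, ← hGF.perp_eq]
      exact hD R hR
    · have h := congrArg vectorsOf (hξ R hR)
      rw [horth] at h
      simp only [vectorsOf_inter, vectorsOf_pointsOf, hGF.vectorsOf_points, hGF.perp_eq] at h
      have h' := Set.ext_iff.1 h v
      constructor
      · exact fun hvD => (h'.1 ⟨hvD, hv⟩).1.2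
      · exact fun hvG => (h'.2 ⟨⟨hv _ (mem_pointsOf_iff.1 hR), hvG⟩, hv⟩).1
  have htan : ∀ R ∈ pointsOf Λ, IsPolarCone t R (F.perp R) (F.points ∩ pointsOf (F.perp R)) := by
    intro R hR
    rw [isPolarCone_iff hc, hGF.perp_eq, vectorsOf_inter, vectorsOf_pointsOf,
      hGF.vectorsOf_points, Set.inter_comm]
    exact PolarForm.isVectorCone_tangent hc hG htG (hs _ (mem_pointsOf_iff.1 hR)) R.rep_nonzero
  have hpiv' : G.IsPivotFamily t Λ fun R => vectorsOf (F.points ∩ pointsOf (F.perp R)) := by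
    refine ⟨fun R hR => ?_, fun R hR v hv => ?_⟩
    · rw [← isPolarCone_iff hc, ← hGF.perp_eq]
      exact htan R hR
    · rw [vectorsOf_inter, vectorsOf_pointsOf, hGF.vectorsOf_points, hGF.perp_eq]
      exact and_iff_left (hv _ (mem_pointsOf_iff.1 hR))
  -- The polar space is the union of its own tangent cones along `Λ`, so it can be compared with
  -- `𝒫'` as a pivot family.
  have hunion : ⋃ R ∈ pointsOf Λ, F.points ∩ pointsOf (F.perp R) = F.points := by
    ext p
    simp only [Set.mem_iUnion, Set.mem_inter_iff, exists_prop]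
    constructor
    · rintro ⟨R, -, hp, -⟩
      exact hp
    · intro hp
      obtain ⟨R, hR, hRp⟩ := PolarForm.exists_mem_pointsOf_bil_eq_zero (G := G) hT h2 p.rep
      exact ⟨R, hR, hp, mem_pointsOf_iff.2 (by rw [hGF.perp_eq]; exact hRp)⟩
  refine ⟨⟨F.points, ⟨F, hF, ht, rfl⟩, ?_⟩, ncard_pointsOf_of_finrank_eq_two h2, ?_,
    fun R hR => ⟨?_, htan R hR, ?_⟩⟩
  · rw [← hunion]
    exact (hpiv.hyperplaneSizes_subset hc h2 hs ⟨P, hP⟩ hpiv').antisymm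
      (hpiv'.hyperplaneSizes_subset hc h2 hs ⟨P, hP⟩ hpiv)
  · rw [show F.perp = fun R => LinearMap.ker (G.bil R.rep) from funext hGF.perp_eq]
    exact PolarForm.injOn_ker_bil hT hG hs
  · rw [hGF.perp_eq]
    refine isCoatom_ker fun h => R.rep_nonzero (hG _ (hs _ (mem_pointsOf_iff.1 hR)) fun y => ?_)
    rw [h, LinearMap.zero_apply]
  · have hsub : ∀ S ∈ pointsOf Λ, D S ⊆ pointsOf (F.perp S) := fun S hS p hp => by
      rw [mem_pointsOf_iff, hGF.perp_eq]
      exact (hpiv.cone S hS).subset (rep_mem_vectorsOf.2 hp)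
    apply Set.Subset.antisymm
    · rintro p ⟨hp, hpR⟩
      obtain ⟨S, hS, hpS⟩ := Set.mem_iUnion₂.1 hp
      -- A point of another cone that lies in `R^⊥` lies in two tangent hyperplanes, hence in `ξ`,
      -- where the cones at `S` and `R` agree.
      by_cases hSR : S = R
      · rwa [← hSR]
      · have h1 := mem_pointsOf_iff.1 (hsub S hS hpS)
        have h3 := mem_pointsOf_iff.1 hpR
        rw [hGF.perp_eq] at h1 h3
        have hpΛ := PolarForm.mem_orthogonal_of_ne h2 hS hR hSR h1 h3
        have h4 := (hpiv.inter S hS _ hpΛ).1 (rep_mem_vectorsOf.2 hpS)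
        exact rep_mem_vectorsOf.1 ((hpiv.inter R hR _ hpΛ).2 h4)
    · exact fun p hp => ⟨Set.mem_iUnion₂.2 ⟨R, hR, hp⟩, hsub R hR hp⟩
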